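/- Let $(X,d)$ be a proper geodesic metric space that is Gromov hyperbolic (for some $\delta>0$ each side of every geodesic triangle lies in the $\delta$-neighbourhood of the union of the other two sides). Let $\partial_GX$ be its Gromov boundary, whose points are the classes of geodesic rays $\gamma:[0,\infty)\to X$ at bounded distance from each other. For points of $X$, convergence to a point of $\partial_GX$ is understood in the Gromov compactification $\overline X^G=X\sqcup\partial_GX$. A geodesic region with vertex $\eta\in\partial_GX$ is a set $\{x\in X: d(x,\gamma)<R\}$ with $R>0$ and $\gamma$ a geodesic ray ending at $\eta$. Let $f:X\to X$ be non-expanding, that is $d(f(x),f(y))\le d(x,y)$ for all $x,y\in X$. We use the following notions. * $f$ is elliptic if it has a bounded forward orbit. It is weakly elliptic if it is elliptic and the union of the $\omega$-limits of its forward orbits is not compact. * For $\eta\in\partial_GX$ and $p\in X$ put $\log\lambda_{\eta,p}(f)=\liminf_{z\to\eta}\bigl(d(z,p)-d(f(z),p)\bigr)$, where $z\in X$. The point $\eta$ is a boundary regular fixed point (BRFP) of $f$ if $\lambda_{\eta,p}(f)<+\infty$ for every $p\in X$ and $f(u_n)\to\eta$ for every sequence $(u_n)$ in $X$ that converges to $\eta$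 and is contained in a geodesic region with vertex $\eta$. * The stable dilation $\Lambda_\eta$ of $f$ at a BRFP $\eta$ is given by $\log\Lambda_\eta=\lim_{n\to\infty}\frac1n\log\lambda_{\eta,p}(f^n)$, which does not depend on $p$. The BRFP $\eta$ is repelling if $\Lambda_\eta>1$ and indifferent if $\Lambda_\eta=1$. * $\zeta\in\partial_GX$ is the Denjoy--Wolff point of $f$ if every forward orbit of $f$ converges to $\zeta$. The map $f$ is parabolic if it is not elliptic and its Denjoy--Wolff point is an indifferent BRFP. * A backward orbit of $f$ is a sequence $(x_n)_{n\ge0}$ in $X$ with $f(x_{n+1})=x_n$ for all $n\ge 0$. It has bounded step if $\sup_n d(x_n,x_{n+1})<\infty$. Its backward step rate is $b(x_n)=\lim_{m\to\infty}\sigma_m/m$, where $\sigma_m=\lim_{n\to\infty}d(x_{n+m},x_n)$ for $m\ge1$. * The horofunction boundary $\partial_HX$ is the set of the points of the closure of $\{[d(\cdot,x)]:x\in X\}$, in the space of continuous real functions on $X$ modulo constants with the topology of uniform convergence on compact sets, that do not belong to $\{[d(\cdot,x)]:x\in X\}$. For $a\in\partial_HX$ and $p\in X$, $h_{a,p}$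 is the representative of $a$ that vanishes at $p$. The point $a$ is associated with $\eta\in\partial_GX$ if $\Phi(a)=\eta$, where $\Phi$ is the continuous extension of the identity of $X$ to a map from the horofunction compactification to $\overline X^G$. **Theorem.** Let $X$ and $f$ be as above, assume that $f$ is not weakly elliptic, and let $(x_n)$ be a backward orbit of $f$ with bounded step that is not relatively compact in $X$. Then the backward step rate $b(x_n)$ exists, and $(x_n)$ converges to a BRFP $\eta\in\partial_GX$ of $f$. Moreover, one of the following holds. 1. $b(x_n)>0$, the BRFP $\eta$ is repelling with $\log\Lambda_\eta=b(x_n)$, the sequence $(x_n)$ is a discrete quasi-geodesic ray (there are $A\ge1$ and $B\ge0$ with $A^{-1}|n-m|-B\le d(x_n,x_m)\le A|n-m|+B$ for all $n,m\ge0$), and $(x_n)$ is contained in a geodesic region with vertex $\eta$. 2. $b(x_n)=0$, the map $f$ is parabolic, $\eta$ is the Denjoy--Wolff point of $f$, and there is a point $a\in\partial_HX$ associated with $\eta$ such that for every $p\in X$ there is $c\in\mathbb R$ for which no $x_n$ belongs to the horosphere $\{h_{a,p}\le c\}$. -/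

import Mathlib

open Filter Topology Set
open scoped NNReal

namespace GromovDynamics

/-! ### Geodesic and Gromov hyperbolic spaces -/

section Hyperbolicity

variable {X : Type*} [MetricSpace X]

/-- `S` is (the image of) a geodesic segment joining `x` and `y`. -/
def IsGeodesicSegment (S : Set X) (x y : X) : Prop :=
  ∃ γ : ℝ → X, γ 0 = x ∧ γ (dist x y) = y ∧
    (∀ s ∈ Icc (0 : ℝ) (dist x y), ∀ t ∈ Icc (0 : ℝ) (dist x y), dist (γ s) (γ t) = |s - t|) ∧
    S = γ '' Icc (0 : ℝ) (dist x y)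

variable (X) in
/-- Any two points are joined by a geodesic segment. -/
def IsGeodesicSpace : Prop := ∀ x y : X, ∃ S : Set X, IsGeodesicSegment S x y

variable (X) in
/-- Geodesic triangles are `δ`-slim. As `x, y, z` are arbitrary, the condition on the first side
is a condition on all three sides. -/
def IsDeltaHyperbolic (δ : ℝ) : Prop :=
  ∀ (x y z : X) (S₁ S₂ S₃ : Set X),
    IsGeodesicSegment S₁ x y → IsGeodesicSegment S₂ y z → IsGeodesicSegment S₃ z x →
      S₁ ⊆ Metric.thickening δ (S₂ ∪ S₃)

variable (X) in
/-- Gromov hyperbolicity of a geodesic space. -/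
def IsGromovHyperbolic : Prop := ∃ δ : ℝ, 0 < δ ∧ IsDeltaHyperbolic X δ

variable (X) in
/-- Geodesic rays `[0, ∞) → X`. -/
def GeodesicRay : Type _ := {γ : ℝ≥0 → X // Isometry γ}

instance : CoeFun (GeodesicRay X) (fun _ => ℝ≥0 → X) := ⟨fun γ => γ.1⟩

variable (X) in
/-- Two geodesic rays are asymptotic when they stay at bounded distance. -/
def asymptoticSetoid : Setoid (GeodesicRay X) where
  r γ σ := ∃ K : ℝ, ∀ t : ℝ≥0, dist (γ t) (σ t) ≤ K
  iseqv :=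
    { refl := fun γ => ⟨0, fun t => by simp⟩
      symm := fun ⟨K, hK⟩ => ⟨K, fun t => by rw [dist_comm]; exact hK t⟩
      trans := fun ⟨K, hK⟩ ⟨L, hL⟩ =>
        ⟨K + L, fun t => (dist_triangle _ _ _).trans (add_le_add (hK t) (hL t))⟩ }

variable (X) in
/-- The Gromov boundary: asymptoty classes of geodesic rays. -/
def GromovBoundary : Type _ := Quotient (asymptoticSetoid X)

/-- The endpoint of a geodesic ray. -/
def GeodesicRay.endpoint (γ : GeodesicRay X) : GromovBoundary X :=
  Quotient.mk (asymptoticSetoid X) γ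

/-- The Gromov product `(x, y)_p`. -/
noncomputable def gromovProduct (p x y : X) : ℝ := (dist x p + dist y p - dist x y) / 2

/-- The trace on `X` of the neighbourhood filter of the boundary point `η` in the Gromov
compactification: a fundamental system is given by the sets of all `x` whose Gromov product with
the points `γ t` of some ray `γ` ending at `η` is eventually at least `r`. -/
def boundaryNhds (η : GromovBoundary X) : Filter X :=
  ⨅ (p : X) (r : ℝ),
    𝓟 {x : X | ∃ γ : GeodesicRay X, γ.endpoint = η ∧ ∀ᶠ t in atTop, r ≤ gromovProduct p x (γ t)}

/-- The geodesic region `A(γ, R)`; its vertex is `γ.endpoint`. -/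
def geodesicRegion (γ : GeodesicRay X) (R : ℝ) : Set X := Metric.thickening R (range γ)

/-- The sequence `u` is contained in a geodesic region with vertex `η`. -/
def InsideGeodesicRegion (u : ℕ → X) (η : GromovBoundary X) : Prop :=
  ∃ (γ : GeodesicRay X) (R : ℝ), γ.endpoint = η ∧ 0 < R ∧ ∀ n, u n ∈ geodesicRegion γ R

/-- The map `f` has geodesic limit `ξ` at `η`. -/
def HasGeodesicLimit (f : X → X) (η ξ : GromovBoundary X) : Prop :=
  ∀ u : ℕ → X, Tendsto u atTop (boundaryNhds η) → InsideGeodesicRegion u η →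
    Tendsto (fun n => f (u n)) atTop (boundaryNhds ξ)

/-- Discrete `(A, B)`-quasi-geodesic rays. -/
def IsDiscreteQuasiGeodesicRay (A B : ℝ) (x : ℕ → X) : Prop :=
  ∀ n m : ℕ, A⁻¹ * |(n : ℝ) - m| - B ≤ dist (x n) (x m) ∧
    dist (x n) (x m) ≤ A * |(n : ℝ) - m| + B

end Hyperbolicity

/-! ### Horofunctions -/

section Horofunctions

variable (X : Type*) [MetricSpace X]

/-- The subgroup of constant functions. -/
def constFunctions : AddSubgroup C(X, ℝ) where
  carrier := {h | ∃ c : ℝ, ∀ x, h x = c}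
  zero_mem' := ⟨0, fun _ => rfl⟩
  add_mem' := by
    rintro g h ⟨c, hc⟩ ⟨d, hd⟩
    exact ⟨c + d, fun x => by simp [hc x, hd x]⟩
  neg_mem' := by
    rintro h ⟨c, hc⟩
    exact ⟨-c, fun x => by simp [hc x]⟩

/-- Continuous functions modulo constants, with the quotient of the topology of uniform convergence
on compact sets. -/
abbrev ContModConst : Type _ := C(X, ℝ) ⧸ constFunctions X

variable {X}

/-- The embedding sending `x` to the class of `y ↦ d(x, y)`. -/
def horoEmbedding (x : X) : ContModConst X :=
  QuotientAddGroup.mk (s := constFunctions X) ⟨fun y => dist x y, by fun_prop⟩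

variable (X) in
/-- The horofunction boundary. -/
def horofunctionBoundary : Set (ContModConst X) :=
  closure (range (horoEmbedding (X := X))) \ range (horoEmbedding (X := X))

/-- The representative `h_{a,p}` of the class `a` that vanishes at `p`. -/
noncomputable def horofunction (a : ContModConst X) (p : X) : C(X, ℝ) :=
  Quotient.out a - ContinuousMap.const X (Quotient.out a p)

theorem mk_horofunction (a : ContModConst X) (p : X) :
    QuotientAddGroup.mk (s := constFunctions X) (horofunction a p) = a := by
  conv_rhs => rw [← QuotientAddGroup.out_eq' a]
  rw [QuotientAddGroup.eq]
  exact ⟨Quotient.out a p, fun x => by simp [horofunction]⟩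

theorem horofunction_self (a : ContModConst X) (p : X) : horofunction a p p = 0 := by
  simp [horofunction]

theorem eq_horofunction (h : C(X, ℝ)) (p : X) (hp : h p = 0) :
    h = horofunction (QuotientAddGroup.mk (s := constFunctions X) h) p := by
  have h1 := mk_horofunction (QuotientAddGroup.mk (s := constFunctions X) h) p
  have h0 := horofunction_self (QuotientAddGroup.mk (s := constFunctions X) h) p
  rw [QuotientAddGroup.eq] at h1
  obtain ⟨c, hc⟩ := h1
  ext x
  have e1 := hc x
  have e2 := hc p
  simp only [ContinuousMap.add_apply, ContinuousMap.neg_apply] at e1 e2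
  linarith

/-- The set `{h_{a,p} ≤ c}`. -/
def horosphere (a : ContModConst X) (p : X) (c : ℝ) : Set X := {x | horofunction a p x ≤ c}

/-- The point `a` of the horofunction boundary is associated with `η`, that is `Φ a = η`, where `Φ`
is the continuous extension of the identity of `X` to a map from the horofunction compactification
to the Gromov compactification: points of `X` tending to `a` tend to `η`. -/
def IsAssociated (a : ContModConst X) (η : GromovBoundary X) : Prop :=
  a ∈ horofunctionBoundary X ∧ Filter.comap horoEmbedding (𝓝 a) ≤ boundaryNhds η

end Horofunctions

/-! ### Dynamics of non-expanding maps -/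

section Dynamics

variable {X : Type*} [MetricSpace X]

/-- The map `f` has a bounded forward orbit. -/
def IsElliptic (f : X → X) : Prop := ∃ x : X, Bornology.IsBounded (range fun n : ℕ => f^[n] x)

/-- The union of the `ω`-limits of all forward orbits. -/
def limitRetract (f : X → X) : Set X := ⋃ x : X, omegaLimit atTop (fun n : ℕ => f^[n]) {x}

/-- Elliptic with non-compact limit retract. -/
def IsWeaklyElliptic (f : X → X) : Prop := IsElliptic f ∧ ¬ IsCompact (limitRetract f)

/-- The logarithm `log λ_{η,p}(f)` of the dilation of `f` at `η` with respect to `p`. -/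
noncomputable def logDilation (f : X → X) (η : GromovBoundary X) (p : X) : EReal :=
  liminf (fun z => ((dist z p - dist (f z) p : ℝ) : EReal)) (boundaryNhds η)

/-- Boundary regular fixed points. -/
def IsBRFP (f : X → X) (η : GromovBoundary X) : Prop :=
  (∀ p : X, logDilation f η p < ⊤) ∧ HasGeodesicLimit f η η

/-- The number `Λ` is the stable dilation of `f` at `η`: for every base point the limit of
`log λ_{η,p}(f^n) / n` exists and equals `log Λ`. -/
def IsStableDilation (f : X → X) (η : GromovBoundary X) (Λ : ℝ) : Prop :=
  0 < Λ ∧ ∀ p : X, Tendsto (fun n : ℕ => logDilation (f^[n]) η p / (n : EReal)) atTop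
    (𝓝 ((Real.log Λ : ℝ) : EReal))

/-- Repelling boundary regular fixed points. -/
def IsRepelling (f : X → X) (η : GromovBoundary X) : Prop :=
  IsBRFP f η ∧ ∃ Λ : ℝ, IsStableDilation f η Λ ∧ 1 < Λ

/-- Indifferent boundary regular fixed points. -/
def IsIndifferent (f : X → X) (η : GromovBoundary X) : Prop :=
  IsBRFP f η ∧ IsStableDilation f η 1

/-- Every forward orbit converges to `ζ`. -/
def IsDenjoyWolffPoint (f : X → X) (ζ : GromovBoundary X) : Prop :=
  ∀ x : X, Tendsto (fun n : ℕ => f^[n] x) atTop (boundaryNhds ζ)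

/-- Non-elliptic with indifferent Denjoy–Wolff point. -/
def IsParabolic (f : X → X) : Prop :=
  ¬ IsElliptic f ∧ ∃ ζ : GromovBoundary X, IsDenjoyWolffPoint f ζ ∧ IsIndifferent f ζ

/-- Backward orbits. -/
def IsBackwardOrbit (f : X → X) (x : ℕ → X) : Prop := ∀ n, f (x (n + 1)) = x n

/-- The step `sup_n d(x_n, x_{n+1})` is finite. -/
def HasBoundedStep (x : ℕ → X) : Prop := ∃ C : ℝ, ∀ n, dist (x n) (x (n + 1)) ≤ C

/-- The number `b` is the backward step rate of `x`: the limits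
`σ_m = lim_n d(x_{n+m}, x_n)` exist for `m ≥ 1`, and `b = lim_m σ_m / m`. -/
def IsBackwardStepRate (x : ℕ → X) (b : ℝ) : Prop :=
  ∃ σ : ℕ → ℝ, (∀ m, 1 ≤ m → Tendsto (fun n => dist (x (n + m)) (x n)) atTop (𝓝 (σ m))) ∧
    Tendsto (fun m : ℕ => σ m / m) atTop (𝓝 b)

end Dynamics

end GromovDynamics

open GromovDynamics

/-!
Write `|y|` for the distance from `y` to a base point `p`, and `(y, z)` for the Gromov product at
`p`. Slimness of triangles is used only through the four-point inequality
`(y, w) ≥ min (y, z) (z, w) - δ` (`HasGromovInequality`).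

**Rate.** Since `f` is non-expanding, `d(x (n + m), x n)` is nondecreasing in `n`; its limit `σ m`
is subadditive in `m`, so that `σ m / m` converges to some `b` (`IsBackwardOrbit.exists_stepRate`).
The orbit escapes to infinity: if it came back to a bounded set infinitely often, then `f` would be
elliptic by Całka's theorem (`isElliptic_of_frequently`), and the whole orbit would lie in the limit
retract, which is compact as `f` is not weakly elliptic (`IsBackwardOrbit.tendsto_dist`).

**Positive rate.** For large `m` the four-point inequality for `x k`, `x (k + m)`, `x (k + 2 * m)`
and `p` shows that `|x (k + m)|` is smaller, by a definite amount, than one of its neighbours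
`|x k|` and `|x (k + 2 * m)|`. As `|x k|` tends to infinity, it eventually increases
by a definite amount along progressions of difference `m`
(`HasGromovInequality.exists_dist_growth`). A chain with this property moves along geodesics issuing
from `p` up to a bounded error (`HasGromovInequality.le_gromovProduct_of_chain`), which gives the
limit `η`, the geodesic region and the quasi-geodesic estimate. Points `z` near `η` satisfy
`d(z, x (k + n)) = |z| - |x (k + n)| + O(1)`, and `f^[n]` sends `x (k + n)` to `x k`, so that
`log λ(f^[n]) = σ n + O(1)` (`HasGromovInequality.isStableDilation_exp`).

**Rate zero.** An elliptic map with compact limit retract has an iterate that decreases `|y|` by a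
definite amount far away, which forces `b > 0` (`IsElliptic.stepRate_pos`). So `f` is not elliptic
and has a Denjoy--Wolff point `ζ`. If the backward orbit did not converge to `ζ`, then some
far away `x n` would have bounded Gromov product with the forward orbit of `p`; since `f^[k]` sends
`x (n + k)` to `x n`, this makes `|x (n + k)|` larger than `|x n|`, and the argument can be
iterated, contradicting `b = 0` (`HasGromovInequality.tendsto_denjoyWolffPoint`). The dilations of
`f^[n]` at `ζ` are at most `σ n` and at least `- d(f^[n] p, p)`, and the escape rate of forward orbits
is at most `b = 0`; hence `f` is parabolic. Finally, the Busemann function of a ray ending at `ζ` is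
not increased by forward iteration, up to a bounded error, so it is bounded below on the backward
orbit (`HasGromovInequality.exists_notMem_horosphere`).

In both cases the limit is a boundary regular fixed point by `HasGromovInequality.isBRFP`.
-/

open GromovDynamics

namespace GromovDynamics

/-! ### The Gromov product -/

section GromovProduct

variable {X : Type*} [MetricSpace X]

theorem gromovProduct_comm (p x y : X) : gromovProduct p x y = gromovProduct p y x := by
  simp only [gromovProduct, dist_comm x y]; ring

theorem gromovProduct_nonneg (p x y : X) : 0 ≤ gromovProduct p x y := by
  have := dist_triangle_right x y p
  unfold gromovProduct; linarith

theorem gromovProduct_le_left (p x y : X) : gromovProduct p x y ≤ dist x p := by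
  have := dist_triangle_left y p x
  unfold gromovProduct; linarith

theorem gromovProduct_sub_dist_le (p x y z : X) :
    gromovProduct p x y - dist y z ≤ gromovProduct p x z := by
  have h1 := dist_triangle y z p
  have h2 := dist_triangle x y z
  unfold gromovProduct; linarith

theorem gromovProduct_sub_dist_le_left (p x y z : X) :
    gromovProduct p x y - dist x z ≤ gromovProduct p z y := by
  rw [gromovProduct_comm p x, gromovProduct_comm p z]
  exact gromovProduct_sub_dist_le p y x z

theorem gromovProduct_sub_dist_le_base (p q x y : X) :
    gromovProduct p x y - dist p q ≤ gromovProduct q x y := by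
  have h1 := dist_triangle_right x p q
  have h2 := dist_triangle_right y p q
  unfold gromovProduct; linarith

variable (X) in
/-- The Gromov product form of hyperbolicity, with constant `δ`. -/
def HasGromovInequality (δ : ℝ) : Prop :=
  ∀ p x y z : X, min (gromovProduct p x y) (gromovProduct p y z) - δ ≤ gromovProduct p x z

theorem IsGeodesicSegment.isPreconnected {S : Set X} {x y : X} (h : IsGeodesicSegment S x y) :
    IsPreconnected S := by
  obtain ⟨γ, -, -, hγ, rfl⟩ := h
  refine isPreconnected_Icc.image _ (LipschitzOnWith.continuousOn (K := 1) ?_)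
  refine LipschitzOnWith.of_dist_le_mul fun s hs t ht => ?_
  simp [hγ s hs t ht, Real.dist_eq]

theorem IsGeodesicSegment.left_mem {S : Set X} {x y : X} (h : IsGeodesicSegment S x y) :
    x ∈ S := by
  obtain ⟨γ, h0, -, -, rfl⟩ := h
  exact ⟨0, ⟨le_rfl, dist_nonneg⟩, h0⟩

theorem IsGeodesicSegment.right_mem {S : Set X} {x y : X} (h : IsGeodesicSegment S x y) :
    y ∈ S := by
  obtain ⟨γ, -, h1, -, rfl⟩ := h
  exact ⟨_, ⟨dist_nonneg, le_rfl⟩, h1⟩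

theorem IsGeodesicSegment.dist_add_dist {S : Set X} {x y u : X} (h : IsGeodesicSegment S x y)
    (hu : u ∈ S) : dist x u + dist u y = dist x y := by
  obtain ⟨γ, h0, h1, hγ, rfl⟩ := h
  obtain ⟨t, ht, rfl⟩ := hu
  have e0 := hγ 0 ⟨le_rfl, dist_nonneg⟩ t ht
  have e1 := hγ t ht _ ⟨dist_nonneg, le_rfl⟩
  rw [h0] at e0
  rw [h1] at e1
  rw [e0, e1, abs_of_nonpos (by linarith [ht.1]), abs_of_nonpos (by linarith [ht.2])]
  ring

theorem IsGeodesicSegment.symm {S : Set X} {x y : X} (h : IsGeodesicSegment S x y) :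
    IsGeodesicSegment S y x := by
  obtain ⟨γ, h0, h1, hγ, rfl⟩ := h
  refine ⟨fun t => γ (dist x y - t), by simpa using h1, by simp [dist_comm y x, h0], ?_, ?_⟩
  · intro s hs t ht
    rw [dist_comm y x] at hs ht
    rw [hγ _ ⟨by linarith [hs.2], by linarith [hs.1]⟩ _ ⟨by linarith [ht.2], by linarith [ht.1]⟩,
      abs_sub_comm]
    congr 1; ring
  · ext z
    simp only [mem_image, dist_comm y x]
    constructor
    · rintro ⟨t, ht, rfl⟩
      exact ⟨dist x y - t, ⟨by linarith [ht.2], by linarith [ht.1]⟩, by simp⟩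
    · rintro ⟨t, ht, rfl⟩
      exact ⟨dist x y - t, ⟨by linarith [ht.2], by linarith [ht.1]⟩, rfl⟩

theorem IsGeodesicSegment.gromovProduct_le_dist {S : Set X} {x y u : X}
    (h : IsGeodesicSegment S x y) (hu : u ∈ S) (p : X) : gromovProduct p x y ≤ dist u p := by
  have h0 := h.dist_add_dist hu
  have h1 := dist_triangle x u p
  have h2 := dist_triangle y u p
  rw [dist_comm y u] at h2
  unfold gromovProduct; linarith

/-- In a slim triangle `p, x, y` the side `[x, y]` is connected and covered by the neighbourhoods of
the two other sides, so that some point of it is close to both; such a point realizes the Gromov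
product up to a bounded error. -/
theorem IsDeltaHyperbolic.exists_dist_le_gromovProduct {δ : ℝ} (hδ : 0 < δ)
    (hX : IsDeltaHyperbolic X δ) (hgeo : IsGeodesicSpace X) {S : Set X} {x y : X}
    (h : IsGeodesicSegment S x y) (p : X) : ∃ u ∈ S, dist u p ≤ gromovProduct p x y + 2 * δ := by
  obtain ⟨S₂, h₂⟩ := hgeo y p
  obtain ⟨S₃, h₃⟩ := hgeo p x
  have hcov := hX x y p S S₂ S₃ h h₂ h₃
  rw [Metric.thickening_union] at hcov
  obtain ⟨u, huS, hu₂, hu₃⟩ := h.isPreconnected _ _ Metric.isOpen_thickening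
    Metric.isOpen_thickening hcov
    ⟨y, h.right_mem, Metric.self_subset_thickening hδ _ h₂.left_mem⟩
    ⟨x, h.left_mem, Metric.self_subset_thickening hδ _ h₃.right_mem⟩
  obtain ⟨v, hv, huv⟩ := Metric.mem_thickening_iff.1 hu₂
  obtain ⟨w, hw, huw⟩ := Metric.mem_thickening_iff.1 hu₃
  refine ⟨u, huS, ?_⟩
  have e0 := h.dist_add_dist huS
  have e1 := h₂.dist_add_dist hv
  have e2 := h₃.dist_add_dist hw
  have t1 := dist_triangle u v p
  have t2 := dist_triangle u w p
  have t3 := dist_triangle_right u y v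
  have t4 := dist_triangle u w x
  rw [dist_comm x u] at e0
  rw [dist_comm p w, dist_comm p x] at e2
  unfold gromovProduct; linarith

theorem IsDeltaHyperbolic.hasGromovInequality {δ : ℝ} (hδ : 0 < δ)
    (hX : IsDeltaHyperbolic X δ) (hgeo : IsGeodesicSpace X) : HasGromovInequality X (3 * δ) := by
  intro p x y z
  obtain ⟨S, h⟩ := hgeo x z
  obtain ⟨S₂, h₂⟩ := hgeo z y
  obtain ⟨S₃, h₃⟩ := hgeo y x
  obtain ⟨u, hu, hup⟩ := hX.exists_dist_le_gromovProduct hδ hgeo h p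
  obtain ⟨v, hv, huv⟩ := Metric.mem_thickening_iff.1 (hX x z y S S₂ S₃ h h₂ h₃ hu)
  have t := dist_triangle_left v p u
  rcases hv with hv | hv
  · have := h₂.symm.gromovProduct_le_dist hv p
    linarith [min_le_right (gromovProduct p x y) (gromovProduct p y z)]
  · have := h₃.symm.gromovProduct_le_dist hv p
    linarith [min_le_left (gromovProduct p x y) (gromovProduct p y z)]

/-- The four-point inequality, with the three Gromov products bounded below separately. -/
theorem HasGromovInequality.le {δ : ℝ} (hX : HasGromovInequality X δ) {p x y z : X} {r : ℝ}
    (h1 : r ≤ gromovProduct p x y) (h2 : r ≤ gromovProduct p y z) :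
    r - δ ≤ gromovProduct p x z :=
  (sub_le_sub_right (le_min h1 h2) δ).trans (hX p x y z)

/-- If the distance to `p` grows by at least `δ` at each step of a finite chain with steps at most
`S`, then the chain behaves like a geodesic issuing from `p`. -/
theorem HasGromovInequality.le_gromovProduct_of_chain {δ : ℝ} (hδ : 0 ≤ δ)
    (hX : HasGromovInequality X δ) {p : X} {S : ℝ} {y : ℕ → X} (n : ℕ)
    (hS : ∀ i < n, dist (y i) (y (i + 1)) ≤ S)
    (hgrow : ∀ i < n, dist (y i) p + δ ≤ dist (y (i + 1)) p) :
    dist (y 0) p - S - δ ≤ gromovProduct p (y 0) (y n) ∨ n = 0 := by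
  induction n generalizing y with
  | zero => exact Or.inr rfl
  | succ n ih =>
    left
    have hs0 := hS 0 (by omega)
    have hg0 := hgrow 0 (by omega)
    have hd0 : 0 ≤ dist (y 0) (y 1) := dist_nonneg
    have h01 : dist (y 0) p - S ≤ gromovProduct p (y 0) (y 1) := by
      simp only [zero_add] at hs0 hg0
      unfold gromovProduct; linarith
    rcases ih (y := fun i => y (i + 1)) (fun i hi => hS (i + 1) (by omega))
      (fun i hi => hgrow (i + 1) (by omega)) with h | h
    · refine hX.le h01 (le_trans ?_ h)
      simp only [zero_add] at hg0 ⊢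
      linarith
    · subst h
      linarith

end GromovProduct

/-! ### Geodesic rays and convergence to the boundary -/

section Rays

variable {X : Type*} [MetricSpace X]

theorem GeodesicRay.dist_eq (γ : GeodesicRay X) (s t : ℝ≥0) :
    dist (γ s) (γ t) = |(s : ℝ) - t| := by
  rw [γ.2.dist_eq, NNReal.dist_eq]

theorem GeodesicRay.gromovProduct_eq (γ : GeodesicRay X) {s t : ℝ≥0} (h : s ≤ t) :
    gromovProduct (γ 0) (γ s) (γ t) = s := by
  have h' : (s : ℝ) ≤ t := h
  simp only [gromovProduct, γ.dist_eq, NNReal.coe_zero, sub_zero]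
  rw [abs_of_nonneg s.coe_nonneg, abs_of_nonneg t.coe_nonneg, abs_of_nonpos (by linarith)]
  ring

theorem GeodesicRay.endpoint_eq_iff {γ σ : GeodesicRay X} :
    γ.endpoint = σ.endpoint ↔ ∃ K : ℝ, ∀ t : ℝ≥0, dist (γ t) (σ t) ≤ K :=
  Quotient.eq (r := asymptoticSetoid X)

/-- Convergence to the endpoint of a ray can be tested on that ray and with one base point. -/
theorem HasGromovInequality.tendsto_boundaryNhds_iff {δ : ℝ}
    (hX : HasGromovInequality X δ) {ι : Type*} {l : Filter ι} {u : ι → X} (γ : GeodesicRay X)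
    (p : X) : Tendsto u l (boundaryNhds γ.endpoint) ↔
      ∀ r : ℝ, ∀ᶠ i in l, ∀ᶠ t in atTop, r ≤ gromovProduct p (u i) (γ t) := by
  simp only [boundaryNhds, tendsto_iInf, tendsto_principal, mem_ofPred_eq]
  constructor
  · intro h r
    filter_upwards [h p (r + δ)] with i hi
    obtain ⟨σ, hσ, hi⟩ := hi
    obtain ⟨K, hK⟩ := GeodesicRay.endpoint_eq_iff.1 hσ
    have hlarge : ∀ᶠ t : ℝ≥0 in atTop, (r + δ + K + dist (σ 0) p).toNNReal ≤ t :=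
      eventually_ge_atTop _
    filter_upwards [hi, hlarge] with t ht1 ht2
    have ht3 : r + δ + K + dist (σ 0) p ≤ t := Real.toNNReal_le_iff_le_coe.1 ht2
    have h1 := (gromovProduct_sub_dist_le_base (σ 0) p (σ t) (σ t))
    rw [σ.gromovProduct_eq le_rfl] at h1
    have h2 := gromovProduct_sub_dist_le p (σ t) (σ t) (γ t)
    have h3 := hK t
    rw [dist_comm] at h3
    have h4 : r + δ ≤ gromovProduct p (σ t) (γ t) := by
      rw [dist_comm (γ t)] at h3
      linarith
    linarith [hX.le ht1 h4]
  · intro h q r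
    filter_upwards [h (r + dist p q)] with i hi
    refine ⟨γ, rfl, ?_⟩
    filter_upwards [hi] with t ht
    linarith [gromovProduct_sub_dist_le_base p q (u i) (γ t)]

theorem HasGromovInequality.eventually_boundaryNhds {δ : ℝ}
    (hX : HasGromovInequality X δ) (γ : GeodesicRay X) (p : X) (r : ℝ) :
    ∀ᶠ z in boundaryNhds γ.endpoint, ∀ᶠ t in atTop, r ≤ gromovProduct p z (γ t) :=
  (hX.tendsto_boundaryNhds_iff γ p).1 tendsto_id r

theorem GeodesicRay.exists_endpoint_eq (η : GromovBoundary X) :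
    ∃ γ : GeodesicRay X, γ.endpoint = η :=
  Quotient.exists_rep η

/-- A sequence at bounded distance from one that converges to `η` converges to `η`. -/
theorem HasGromovInequality.tendsto_of_dist_le {δ : ℝ} (hX : HasGromovInequality X δ)
    {ι : Type*} {l : Filter ι} {u v : ι → X} {η : GromovBoundary X} {K : ℝ}
    (hu : Tendsto u l (boundaryNhds η)) (huv : ∀ i, dist (u i) (v i) ≤ K) :
    Tendsto v l (boundaryNhds η) := by
  obtain ⟨γ, rfl⟩ := GeodesicRay.exists_endpoint_eq η
  rw [hX.tendsto_boundaryNhds_iff γ (γ 0)] at hu ⊢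
  intro r
  filter_upwards [hu (r + K)] with i hi
  filter_upwards [hi] with t ht
  linarith [gromovProduct_sub_dist_le_left (γ 0) (u i) (γ t) (v i), huv i]

theorem HasGromovInequality.tendsto_dist_boundaryNhds {δ : ℝ} (hX : HasGromovInequality X δ)
    (η : GromovBoundary X) (p : X) : Tendsto (fun z => dist z p) (boundaryNhds η) atTop := by
  obtain ⟨γ, rfl⟩ := GeodesicRay.exists_endpoint_eq η
  refine tendsto_atTop.2 fun r => ?_
  filter_upwards [hX.eventually_boundaryNhds γ p r] with z hz
  obtain ⟨t, ht⟩ := hz.exists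
  exact ht.trans (gromovProduct_le_left _ _ _)

/-- Seen from `p`, the points of a geodesic region lie, up to a bounded error, on geodesics towards
the vertex of the region. -/
theorem HasGromovInequality.exists_forall_mem_geodesicRegion {δ : ℝ}
    (hX : HasGromovInequality X δ) (γ : GeodesicRay X) (R : ℝ) (p : X) :
    ∃ c : ℝ, ∀ u ∈ geodesicRegion γ R, ∀ᶠ z in boundaryNhds γ.endpoint,
      dist u p - c ≤ gromovProduct p u z := by
  refine ⟨2 * R + 2 * dist (γ 0) p + |δ|, fun u hu => ?_⟩
  obtain ⟨_, ⟨s, rfl⟩, hs⟩ := Metric.mem_thickening_iff.1 hu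
  filter_upwards [hX.eventually_boundaryNhds γ p (dist u p)] with z hz
  obtain ⟨t, ht, hst⟩ := (hz.and (eventually_ge_atTop s)).exists
  have h1 := gromovProduct_sub_dist_le_base (γ 0) p (γ s) (γ t)
  rw [γ.gromovProduct_eq hst] at h1
  have h2 := gromovProduct_sub_dist_le_left p (γ s) (γ t) u
  rw [dist_comm] at h2
  have h3 := dist_triangle u (γ s) p
  have h4 := dist_triangle (γ s) (γ 0) p
  rw [γ.dist_eq, NNReal.coe_zero, sub_zero, abs_of_nonneg s.coe_nonneg] at h4
  have hR : 0 ≤ R := dist_nonneg.trans hs.le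
  have h5 : dist u p - 2 * R - 2 * dist (γ 0) p ≤ gromovProduct p u (γ t) := by
    linarith
  have h6 : dist u p - 2 * R - 2 * dist (γ 0) p ≤ gromovProduct p (γ t) z := by
    rw [gromovProduct_comm]
    linarith [dist_nonneg (x := γ 0) (y := p)]
  linarith [hX.le h5 h6, le_abs_self δ]

/-- Initial segments of geodesics from `p` to points escaping to infinity subconverge to a geodesic
ray from `p`. The subsequence is encoded by the ultrafilter `hyperfilter ℕ`. -/
theorem exists_ray_of_tendsto_dist [ProperSpace X] (hgeo : IsGeodesicSpace X) {p : X} {y : ℕ → X}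
    (hy : Tendsto (fun n => dist (y n) p) atTop atTop) :
    ∃ γ : GeodesicRay X, γ 0 = p ∧
      ∀ t : ℝ≥0, ∃ᶠ m in atTop, t - 1 ≤ gromovProduct p (y m) (γ t) := by
  choose S hS using fun n => hgeo p (y n)
  choose g hg0 hg1 hg hgS using hS
  let U : Ultrafilter ℕ := hyperfilter ℕ
  have hU : (U : Filter ℕ) ≤ atTop := by
    rw [← Nat.cofinite_eq_atTop]; exact hyperfilter_le_cofinite
  have hlarge (t : ℝ≥0) : ∀ᶠ n in (U : Filter ℕ), (t : ℝ) ∈ Icc (0 : ℝ) (dist p (y n)) := by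
    filter_upwards [hU (hy.eventually_ge_atTop (t : ℝ))] with n hn
    exact ⟨t.2, by rwa [dist_comm]⟩
  have hp (n : ℕ) (t : ℝ≥0) (ht : (t : ℝ) ∈ Icc (0 : ℝ) (dist p (y n))) : dist (g n t) p = t := by
    have := hg n t ht 0 ⟨le_rfl, dist_nonneg⟩
    rwa [hg0, sub_zero, abs_of_nonneg t.coe_nonneg] at this
  have hlim (t : ℝ≥0) : ∃ z, Tendsto (fun n => g n t) U (𝓝 z) := by
    have hmem : ((U.map fun n => g n t : Ultrafilter X) : Filter X) ≤
        𝓟 (Metric.closedBall p t) := by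
      rw [Filter.le_principal_iff, Ultrafilter.coe_map, Filter.mem_map]
      filter_upwards [hlarge t] with n hn
      exact (hp n t hn).le
    obtain ⟨z, -, hz⟩ := (isCompact_closedBall p (t : ℝ)).ultrafilter_le_nhds _ hmem
    exact ⟨z, hz⟩
  choose γ hγ using hlim
  have hiso : Isometry γ := by
    refine Isometry.of_dist_eq fun s t => ?_
    refine tendsto_nhds_unique ((hγ s).dist (hγ t)) (tendsto_const_nhds.congr' ?_)
    filter_upwards [hlarge s, hlarge t] with n hs ht
    rw [hg n s hs t ht, NNReal.dist_eq]
  refine ⟨⟨γ, hiso⟩, ?_, fun t => ?_⟩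
  · refine tendsto_nhds_unique (hγ 0) (tendsto_const_nhds.congr fun n => ?_)
    simp [hg0]
  · have hev : ∀ᶠ m in (U : Filter ℕ), (t : ℝ) - 1 ≤ gromovProduct p (y m) (γ t) := by
      filter_upwards [hlarge t, (hγ t) (Metric.ball_mem_nhds _ one_pos)] with m hm hm1
      have e1 := hp m t hm
      have e2 := hg m t hm _ ⟨dist_nonneg, le_rfl⟩
      rw [hg1, abs_of_nonpos (by linarith [hm.2])] at e2
      have e3 := gromovProduct_sub_dist_le p (y m) (g m t) (γ t)
      have e4 : gromovProduct p (y m) (g m t) = t := by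
        unfold gromovProduct
        rw [dist_comm (y m) (g m t), e1, e2, dist_comm p]; ring
      have e5 : dist (g m t) (γ t) < 1 := hm1
      linarith
    exact hev.frequently.filter_mono hU

/-- Gromov sequences converge to a boundary point. -/
theorem HasGromovInequality.exists_tendsto_boundaryNhds [ProperSpace X] {δ : ℝ}
    (hX : HasGromovInequality X δ) (hgeo : IsGeodesicSpace X) {p : X} {y : ℕ → X}
    (hy : ∀ r : ℝ, ∃ N, ∀ n ≥ N, ∀ m ≥ N, r ≤ gromovProduct p (y n) (y m)) :
    ∃ γ : GeodesicRay X, γ 0 = p ∧ Tendsto y atTop (boundaryNhds γ.endpoint) := by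
  have hdist : Tendsto (fun n => dist (y n) p) atTop atTop := by
    refine tendsto_atTop.2 fun r => ?_
    obtain ⟨N, hN⟩ := hy r
    filter_upwards [eventually_ge_atTop N] with n hn
    exact (hN n hn n hn).trans (gromovProduct_le_left _ _ _)
  obtain ⟨γ, h0, hγ⟩ := exists_ray_of_tendsto_dist hgeo hdist
  refine ⟨γ, h0, (hX.tendsto_boundaryNhds_iff γ p).2 fun r => ?_⟩
  obtain ⟨N, hN⟩ := hy (r + δ)
  filter_upwards [eventually_ge_atTop N] with n hn
  filter_upwards [eventually_ge_atTop (r + δ + 1).toNNReal] with t ht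
  have ht' : r + δ + 1 ≤ t := Real.toNNReal_le_iff_le_coe.1 ht
  obtain ⟨m, hm1, hm2⟩ := ((hγ t).and_eventually (eventually_ge_atTop N)).exists
  have := hX.le (hN n hn m hm2) (by linarith : r + δ ≤ _)
  linarith

end Rays

/-! ### Forward dynamics of non-expanding maps -/

section ForwardDynamics

variable {X : Type*} [MetricSpace X] {f : X → X}

theorem dist_iterate_le (hf : LipschitzWith 1 f) (n : ℕ) (x y : X) :
    dist (f^[n] x) (f^[n] y) ≤ dist x y := by
  simpa using (hf.iterate n).dist_le_mul x y

theorem dist_iterate_self_le (hf : LipschitzWith 1 f) (n : ℕ) (x : X) :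
    dist (f^[n] x) x ≤ n * dist (f x) x := by
  induction n with
  | zero => simp
  | succ n ih =>
    have h1 := dist_triangle (f^[n + 1] x) (f^[n] x) x
    have h2 := dist_iterate_le hf n (f x) x
    rw [← Function.iterate_succ_apply] at h2
    push_cast
    linarith

/-- A point that returns arbitrarily close to itself has a bounded orbit: by compactness, the
orbit returns to the unit ball around the point with bounded gaps. -/
theorem isBounded_orbit_of_recurrent [ProperSpace X] (hf : LipschitzWith 1 f) {q : X}
    (hq : ∀ ε > 0, ∀ N : ℕ, ∃ m ≥ N, dist (f^[m] q) q < ε) :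
    Bornology.IsBounded (range fun n : ℕ => f^[n] q) := by
  have hK : IsCompact (Metric.closedBall q 1 ∩ closure (range fun n : ℕ => f^[n] q)) :=
    (isCompact_closedBall q 1).inter_right isClosed_closure
  obtain ⟨T, hT⟩ := hK.elim_finite_subcover (fun j : ℕ => f^[j + 1] ⁻¹' Metric.ball q 1)
    (fun j => Metric.isOpen_ball.preimage (hf.iterate (j + 1)).continuous) (by
      rintro y ⟨-, hy⟩
      obtain ⟨_, ⟨l, rfl⟩, hl⟩ := Metric.mem_closure_iff.1 hy (1 / 2) (by norm_num)
      obtain ⟨m, hm, hmq⟩ := hq (1 / 2) (by norm_num) (l + 1)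
      refine mem_iUnion.2 ⟨m - l - 1, ?_⟩
      have h1 := dist_iterate_le hf (m - l) y (f^[l] q)
      rw [← Function.iterate_add_apply, Nat.sub_add_cancel (by omega)] at h1
      have h2 := dist_triangle (f^[m - l] y) (f^[m] q) q
      rw [mem_preimage, Nat.sub_add_cancel (by omega), Metric.mem_ball]
      have hl' : dist y (f^[l] q) < 1 / 2 := hl
      linarith)
  obtain ⟨J, hJ⟩ : ∃ J : ℕ, ∀ j ∈ T, j + 1 ≤ J :=
    ⟨T.sup (· + 1), fun j hj => Finset.le_sup (f := (· + 1)) hj⟩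
  have key (n : ℕ) : ∃ t r : ℕ, n = t + r ∧ r ≤ J ∧ dist (f^[t] q) q ≤ 1 := by
    induction n with
    | zero => exact ⟨0, 0, rfl, Nat.zero_le _, by simp⟩
    | succ n ih =>
      obtain ⟨t, r, rfl, hr, ht⟩ := ih
      by_cases hrJ : r + 1 ≤ J
      · exact ⟨t, r + 1, rfl, hrJ, ht⟩
      · obtain ⟨j, hj⟩ := mem_iUnion.1 (hT ⟨ht, subset_closure ⟨t, rfl⟩⟩)
        obtain ⟨hjT, hj⟩ := mem_iUnion.1 hj
        have := hJ j hjT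
        refine ⟨j + 1 + t, J - j, by omega, by omega, ?_⟩
        rw [Function.iterate_add_apply]
        exact (Metric.mem_ball.1 hj).le
  refine (Metric.isBounded_closedBall (x := q) (r := 1 + J * dist (f q) q)).subset ?_
  rintro _ ⟨n, rfl⟩
  obtain ⟨t, r, rfl, hr, ht⟩ := key n
  have h1 := dist_iterate_le hf r (f^[t] q) q
  have h2 := dist_iterate_self_le hf r q
  have h3 := dist_triangle (f^[r] (f^[t] q)) (f^[r] q) q
  have h4 : (r : ℝ) * dist (f q) q ≤ J * dist (f q) q := by gcongr
  have h5 : f^[t + r] q = f^[r] (f^[t] q) := by rw [add_comm, Function.iterate_add_apply]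
  simp only [Metric.mem_closedBall, h5]
  linarith

/-- Całka's theorem: in a proper space, an orbit of a non-expanding map that does not escape to
infinity forces the map to be elliptic. -/
theorem isElliptic_of_frequently [ProperSpace X] (hf : LipschitzWith 1 f) {p : X} {R : ℝ}
    (h : ∃ᶠ n in atTop, dist (f^[n] p) p ≤ R) : IsElliptic f := by
  obtain ⟨q, -, φ, hφ, hq⟩ := tendsto_subseq_of_frequently_bounded
    (Metric.isBounded_closedBall (x := p) (r := R)) (x := fun n => f^[n] p) h
  refine ⟨q, isBounded_orbit_of_recurrent hf fun ε hε N => ?_⟩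
  obtain ⟨K, hK⟩ := Metric.tendsto_atTop.1 hq (ε / 2) (half_pos hε)
  have h1 := hK K le_rfl
  have h2 := hK (φ K + N + K) (by omega)
  have hle : φ K + N + K ≤ φ (φ K + N + K) := hφ.id_le _
  refine ⟨φ (φ K + N + K) - φ K, by omega, ?_⟩
  have h3 := dist_iterate_le hf (φ (φ K + N + K) - φ K) q (f^[φ K] p)
  rw [← Function.iterate_add_apply, Nat.sub_add_cancel (by omega), dist_comm q] at h3
  simp only [Function.comp_apply] at h1 h2
  linarith [dist_triangle (f^[φ (φ K + N + K) - φ K] q) (f^[φ (φ K + N + K)] p) q]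

theorem tendsto_dist_iterate [ProperSpace X] (hf : LipschitzWith 1 f) (he : ¬ IsElliptic f)
    (p : X) : Tendsto (fun n => dist (f^[n] p) p) atTop atTop := by
  refine tendsto_atTop.2 fun R => ?_
  by_contra h
  exact he (isElliptic_of_frequently hf ((not_eventually.1 h).mono fun n hn => (not_le.1 hn).le))

/-- The Denjoy--Wolff theorem: comparing two points of an orbit with a later record
time `n`, when `dist (f^[n] p) p` exceeds all previous distances, shows that a divergent orbit is a
Gromov sequence. -/
theorem HasGromovInequality.exists_isDenjoyWolffPoint [ProperSpace X] {δ : ℝ}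
    (hX : HasGromovInequality X δ) (hgeo : IsGeodesicSpace X) (hf : LipschitzWith 1 f)
    (he : ¬ IsElliptic f) (p : X) : ∃ ζ : GromovBoundary X, IsDenjoyWolffPoint f ζ := by
  have ht := tendsto_dist_iterate hf he p
  have hrec {n k : ℕ} (hkn : k < n) (hn : ∀ j < n, dist (f^[j] p) p < dist (f^[n] p) p) :
      dist (f^[k] p) p / 2 ≤ gromovProduct p (f^[k] p) (f^[n] p) := by
    rcases Nat.eq_zero_or_pos k with rfl | hk
    · simpa using gromovProduct_nonneg _ _ _
    have h1 := hn (n - k) (by omega)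
    have h2 := dist_iterate_le hf k p (f^[n - k] p)
    rw [← Function.iterate_add_apply, Nat.add_sub_cancel' hkn.le, dist_comm p] at h2
    unfold gromovProduct; linarith
  obtain ⟨γ, -, hγ⟩ := hX.exists_tendsto_boundaryNhds hgeo (p := p) (y := fun n => f^[n] p) (by
    intro r
    obtain ⟨N, hN⟩ := eventually_atTop.1 (ht.eventually_ge_atTop (2 * (r + δ)))
    refine ⟨N, fun k hk l hl => ?_⟩
    obtain ⟨n, hn, hn'⟩ := ((frequently_high_scores ht).and_eventually
      (eventually_gt_atTop (max k l))).exists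
    have h1 := hrec (lt_of_le_of_lt (le_max_left k l) hn') hn
    have h2 := hrec (lt_of_le_of_lt (le_max_right k l) hn') hn
    rw [gromovProduct_comm] at h2
    have hk' : r + δ ≤ dist (f^[k] p) p / 2 := by linarith [hN k hk]
    have hl' : r + δ ≤ dist (f^[l] p) p / 2 := by linarith [hN l hl]
    linarith [hX.le (hk'.trans h1) (hl'.trans h2)])
  exact ⟨γ.endpoint, fun x => hX.tendsto_of_dist_le hγ fun n => dist_iterate_le hf n p x⟩

/-- If `f` is elliptic with compact limit retract, then an iterate of `f` decreases the distance to
the base point by a definite amount far away from it. -/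
theorem IsElliptic.exists_dist_iterate_add_one_le [ProperSpace X] (hgeo : IsGeodesicSpace X)
    (hf : LipschitzWith 1 f) (he : IsElliptic f) (hL : IsCompact (limitRetract f)) (p : X) :
    ∃ M : ℕ, 1 ≤ M ∧ ∃ R : ℝ, ∀ x, R ≤ dist x p → dist (f^[M] x) p + 1 ≤ dist x p := by
  obtain ⟨r, hr⟩ := hL.isBounded.subset_ball p
  have hball (y : X) : ∀ᶠ n in atTop, f^[n] y ∈ Metric.ball p r := by
    obtain ⟨q, hq⟩ := he
    obtain ⟨B, hB⟩ := hq.subset_closedBall p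
    have h := eventually_mapsTo_of_isCompact_absorbing_of_isOpen_of_omegaLimit_subset
      (f := atTop) (ϕ := fun n : ℕ => f^[n]) (s := {y}) (n := Metric.ball p r)
      (isCompact_closedBall p (dist y q + B))
      (Eventually.of_forall fun n => by
        intro z hz
        have h1 := dist_iterate_le hf n y q
        have h2 : dist (f^[n] q) p ≤ B := hB ⟨n, rfl⟩
        rw [mem_singleton_iff.1 hz, Metric.mem_closedBall]
        linarith [dist_triangle (f^[n] y) (f^[n] q) p])
      Metric.isOpen_ball
      (fun z hz => hr (mem_iUnion.2 ⟨y, hz⟩))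
    exact h.mono fun n hn => hn rfl
  set R := |r| + 2
  obtain ⟨T, -, hT, hcov⟩ := (isCompact_closedBall p R).finite_cover_balls one_pos
  obtain ⟨M, hM, hM1⟩ := (((eventually_all_finite hT).2 fun y _ => hball y).and
    (eventually_ge_atTop 1)).exists
  refine ⟨M, hM1, R, fun x hx => ?_⟩
  obtain ⟨S, γ, h0, h1, hγ, -⟩ := hgeo p x
  rw [dist_comm] at hx
  have hR : 0 ≤ R := by positivity
  have e0 := hγ 0 ⟨le_rfl, dist_nonneg⟩ R ⟨hR, hx⟩
  have e1 := hγ R ⟨hR, hx⟩ _ ⟨dist_nonneg, le_rfl⟩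
  rw [h0, zero_sub, abs_neg, abs_of_nonneg hR, dist_comm] at e0
  rw [h1, abs_of_nonpos (by linarith)] at e1
  obtain ⟨y, hy, hyR⟩ := mem_iUnion₂.1 (hcov e0.le)
  have d1 := dist_iterate_le hf M x (γ R)
  have d2 := dist_iterate_le hf M (γ R) y
  have d3 : dist (f^[M] y) p < r := hM y hy
  have d4 : dist (γ R) y < 1 := hyR
  have d5 := dist_triangle4 (f^[M] x) (f^[M] (γ R)) (f^[M] y) p
  rw [dist_comm x (γ R)] at d1
  rw [dist_comm x p]
  linarith [le_abs_self r]

/-- The escape rate `lim d(f^n p, p) / n` is at most `d(f^m z, z) / m` for all `z` and `m`. -/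
theorem tendsto_dist_iterate_div (hf : LipschitzWith 1 f) (p : X) :
    ∃ c : ℝ, Tendsto (fun n : ℕ => dist (f^[n] p) p / n) atTop (𝓝 c) ∧
      ∀ (z : X) (m : ℕ), c * m ≤ dist (f^[m] z) z := by
  have hsub (z : X) : Subadditive fun n => dist (f^[n] z) z := fun m n => by
    have h1 := dist_triangle (f^[m + n] z) (f^[m] z) z
    have h2 := dist_iterate_le hf m (f^[n] z) z
    rw [← Function.iterate_add_apply] at h2
    linarith
  have hbdd (z : X) : BddBelow (range fun n : ℕ => dist (f^[n] z) z / n) :=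
    ⟨0, by rintro _ ⟨n, rfl⟩; positivity⟩
  refine ⟨(hsub p).lim, (hsub p).tendsto_lim (hbdd p), fun z m => ?_⟩
  have hlim : (hsub p).lim = (hsub z).lim := by
    refine tendsto_nhds_unique ((hsub p).tendsto_lim (hbdd p)) ?_
    have h0 : Tendsto (fun n : ℕ => 2 * dist p z / n) atTop (𝓝 0) :=
      tendsto_const_div_atTop_nhds_zero_nat _
    have hz := (hsub z).tendsto_lim (hbdd z)
    refine tendsto_of_tendsto_of_tendsto_of_le_of_le (by simpa using hz.sub h0)
      (by simpa using hz.add h0) (fun n => ?_) (fun n => ?_)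
    all_goals
      have h1 := dist_iterate_le hf n p z
      have h2 := dist_triangle4 (f^[n] p) (f^[n] z) z p
      have h3 := dist_triangle4 (f^[n] z) (f^[n] p) p z
      simp only
      rw [dist_comm z p] at h2
      rw [dist_comm (f^[n] z) (f^[n] p)] at h3
      simp only [← sub_div, ← add_div]
      gcongr
      linarith
  rcases Nat.eq_zero_or_pos m with rfl | hm
  · simp
  · rw [hlim, ← le_div_iff₀ (by exact_mod_cast hm)]
    exact (hsub z).lim_le_div (hbdd z) hm.ne'

end ForwardDynamics

/-! ### Backward orbits -/

section BackwardOrbits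

variable {X : Type*} {f : X → X} {x : ℕ → X}

theorem IsBackwardOrbit.iterate_apply (hx : IsBackwardOrbit f x) (n k : ℕ) :
    f^[k] (x (n + k)) = x n := by
  induction k with
  | zero => rfl
  | succ k ih => rw [Function.iterate_succ_apply, ← add_assoc, hx, ih]

theorem IsBackwardOrbit.iterate_apply_of_le (hx : IsBackwardOrbit f x) {n m : ℕ} (h : n ≤ m) :
    f^[m - n] (x m) = x n := by
  obtain ⟨k, rfl⟩ := Nat.exists_eq_add_of_le h
  rw [Nat.add_sub_cancel_left, hx.iterate_apply]

variable [MetricSpace X]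

theorem dist_le_mul_of_step {C : ℝ} (hC : ∀ n, dist (x n) (x (n + 1)) ≤ C) (n m : ℕ) :
    dist (x (n + m)) (x n) ≤ m * C := by
  induction m with
  | zero => simp
  | succ m ih =>
    have h1 := dist_triangle_left (x (n + (m + 1))) (x n) (x (n + m))
    have h2 := hC (n + m)
    push_cast
    rw [← add_assoc] at h1 ⊢
    linarith

theorem dist_iterate_add_le (hf : LipschitzWith 1 f) (hx : IsBackwardOrbit f x) (n m k : ℕ) :
    dist (x n) (x m) ≤ dist (x (n + k)) (x (m + k)) := by
  have := dist_iterate_le hf k (x (n + k)) (x (m + k))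
  rwa [hx.iterate_apply, hx.iterate_apply] at this

/-- The limits `σ m` of the `m`-steps exist by monotonicity, and the rate `b` by subadditivity. -/
theorem IsBackwardOrbit.exists_stepRate (hf : LipschitzWith 1 f) (hx : IsBackwardOrbit f x)
    (hstep : HasBoundedStep x) :
    ∃ (σ : ℕ → ℝ) (b : ℝ), (∀ m n, dist (x (n + m)) (x n) ≤ σ m) ∧
      (∀ m, Tendsto (fun n => dist (x (n + m)) (x n)) atTop (𝓝 (σ m))) ∧
      Tendsto (fun m : ℕ => σ m / m) atTop (𝓝 b) ∧ (∀ m, b * m ≤ σ m) ∧ 0 ≤ b := by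
  obtain ⟨C, hC⟩ := hstep
  have hbdd (m : ℕ) : BddAbove (range fun n => dist (x (n + m)) (x n)) :=
    ⟨m * C, by rintro _ ⟨n, rfl⟩; exact dist_le_mul_of_step hC n m⟩
  have hmono (m : ℕ) : Monotone fun n => dist (x (n + m)) (x n) := by
    refine monotone_nat_of_le_succ fun n => ?_
    have := dist_iterate_add_le hf hx (n + m) n 1
    rwa [add_right_comm] at this
  let σ : ℕ → ℝ := fun m => ⨆ n, dist (x (n + m)) (x n)
  have hle (m n : ℕ) : dist (x (n + m)) (x n) ≤ σ m := le_ciSup (hbdd m) n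
  have hsub : Subadditive σ := fun m k => ciSup_le fun n => by
    have h1 := dist_triangle (x (n + (m + k))) (x (n + m)) (x n)
    have h2 := hle m n
    have h3 := hle k (n + m)
    rw [← add_assoc] at h1 ⊢
    linarith
  have hσ (m : ℕ) : 0 ≤ σ m := dist_nonneg.trans (hle m 0)
  have hb : BddBelow (range fun n : ℕ => σ n / n) :=
    ⟨0, by rintro _ ⟨n, rfl⟩; exact div_nonneg (hσ n) n.cast_nonneg⟩
  refine ⟨σ, hsub.lim, hle, fun m => tendsto_atTop_ciSup (hmono m) (hbdd m),
    hsub.tendsto_lim hb, fun m => ?_,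
    ge_of_tendsto' (hsub.tendsto_lim hb) fun n => div_nonneg (hσ n) n.cast_nonneg⟩
  rcases Nat.eq_zero_or_pos m with rfl | hm
  · simpa using hσ 0
  · rw [← le_div_iff₀ (by exact_mod_cast hm)]
    exact hsub.lim_le_div hb hm.ne'

/-- If a backward orbit returns to a bounded set infinitely often, then each of its points is a
limit point of the forward orbit of an accumulation point of the backward orbit. -/
theorem IsBackwardOrbit.mem_limitRetract [ProperSpace X] (hf : LipschitzWith 1 f)
    (hx : IsBackwardOrbit f x) {p : X} {R : ℝ} (h : ∃ᶠ n in atTop, dist (x n) p ≤ R) (n : ℕ) :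
    x n ∈ limitRetract f := by
  obtain ⟨q, -, φ, hφ, hq⟩ := tendsto_subseq_of_frequently_bounded
    (Metric.isBounded_closedBall (x := p) (r := R)) (x := x) h
  refine mem_iUnion.2 ⟨q, (mem_omegaLimit_singleton_iff_mapClusterPt _ _ _ _).2 ?_⟩
  have hφn : Tendsto (fun k => φ k - n) atTop atTop :=
    (tendsto_sub_atTop_nat n).comp hφ.tendsto_atTop
  refine MapClusterPt.of_comp hφn (Tendsto.mapClusterPt ?_)
  refine tendsto_iff_dist_tendsto_zero.2
    (squeeze_zero' (Eventually.of_forall fun _ => dist_nonneg) ?_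
      (tendsto_iff_dist_tendsto_zero.1 hq))
  filter_upwards [hφ.tendsto_atTop.eventually_ge_atTop n] with k hk
  have h1 := dist_iterate_le hf (φ k - n) q (x (φ k))
  rwa [hx.iterate_apply_of_le hk, dist_comm q] at h1

/-- A backward orbit that is not relatively compact escapes to infinity, unless `f` is weakly
elliptic. -/
theorem IsBackwardOrbit.tendsto_dist [ProperSpace X] (hf : LipschitzWith 1 f)
    (hwe : ¬ IsWeaklyElliptic f) (hx : IsBackwardOrbit f x)
    (hnc : ¬ IsCompact (closure (range x))) (p : X) :
    Tendsto (fun n => dist (x n) p) atTop atTop := by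
  refine tendsto_atTop.2 fun R => ?_
  by_contra h
  have h' : ∃ᶠ n in atTop, dist (x n) p ≤ R :=
    (not_eventually.1 h).mono fun n hn => (not_le.1 hn).le
  have he : IsElliptic f := by
    refine isElliptic_of_frequently hf (p := p) (R := R + dist (x 0) p) (h'.mono fun n hn => ?_)
    have h1 := dist_iterate_le hf n p (x n)
    have h2 := hx.iterate_apply 0 n
    rw [zero_add] at h2
    rw [h2, dist_comm p] at h1
    linarith [dist_triangle (f^[n] p) (x 0) p]
  have hL : IsCompact (limitRetract f) := by
    by_contra hL
    exact hwe ⟨he, hL⟩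
  exact hnc (hL.closure_of_subset (range_subset_iff.2 (hx.mem_limitRetract hf h')))

end BackwardOrbits

/-! ### Dilations along backward orbits -/

section Dilation

variable {X : Type*} [MetricSpace X] {f : X → X} {x : ℕ → X}

/-- The dilation is bounded above by the displacement along any sequence tending to `η`. -/
theorem logDilation_le_of_tendsto {η : GromovBoundary X} {u : ℕ → X}
    (hu : Tendsto u atTop (boundaryNhds η)) {g : X → X} {p : X} {c : ℝ}
    (h : ∀ n, dist (u n) p - dist (g (u n)) p ≤ c) : logDilation g η p ≤ c := by
  exact hu.liminf_le_liminf_comp.trans (liminf_le_of_frequently_le'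
    (Frequently.of_forall fun n => EReal.coe_le_coe_iff.2 (h n)))

theorem le_logDilation_of_eventually {η : GromovBoundary X} {g : X → X} {p : X} {c : ℝ}
    (h : ∀ᶠ z in boundaryNhds η, c ≤ dist z p - dist (g z) p) : (c : EReal) ≤ logDilation g η p :=
  le_liminf_of_le (by isBoundedDefault) (h.mono fun z hz => EReal.coe_le_coe_iff.2 hz)

/-- A non-expanding map has `η` as boundary regular fixed point as soon as some backward orbit with
bounded step converges to `η`: for `u` in a geodesic region with vertex `η`, comparison of `f u`
with the points of the backward orbit bounds the Gromov product of `f u` and `η` from below by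
`d(u, p) / 2` up to an additive constant. -/
theorem HasGromovInequality.isBRFP {δ : ℝ} (hX : HasGromovInequality X δ)
    (hf : LipschitzWith 1 f) (hx : IsBackwardOrbit f x) (hstep : HasBoundedStep x)
    {η : GromovBoundary X} (hη : Tendsto x atTop (boundaryNhds η)) : IsBRFP f η := by
  obtain ⟨C, hC⟩ := hstep
  have hη1 : Tendsto (fun n => x (n + 1)) atTop (boundaryNhds η) :=
    (tendsto_add_atTop_iff_nat 1).2 hη
  refine ⟨fun p => lt_of_le_of_lt (logDilation_le_of_tendsto hη1 (c := C) fun n => ?_)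
    (EReal.coe_lt_top C), ?_⟩
  · rw [hx]
    linarith [hC n, dist_triangle_left (x (n + 1)) p (x n)]
  rintro u hu ⟨γ, R, rfl, -, huR⟩
  set p := γ 0
  obtain ⟨c, hc⟩ := hX.exists_forall_mem_geodesicRegion γ R p
  rw [hX.tendsto_boundaryNhds_iff γ p]
  intro r
  have hdist := (hX.tendsto_dist_boundaryNhds γ.endpoint p).comp hu
  filter_upwards [hdist.eventually_ge_atTop (2 * (r + δ) + C + 2 * c)] with n hn
  obtain ⟨k, hk1, hk2⟩ := ((hη1.eventually (hc (u n) (huR n))).and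
    ((hX.tendsto_boundaryNhds_iff γ p).1 hη (r + δ))).exists
  filter_upwards [hk2] with t ht
  have h1 : r + δ ≤ gromovProduct p (f (u n)) (x k) := by
    have h2 := hf.dist_le_mul (u n) (x (k + 1))
    rw [hx, NNReal.coe_one, one_mul] at h2
    have h3 := dist_triangle_left (x (k + 1)) p (x k)
    have h4 := hC k
    have h5 : 0 ≤ dist (f (u n)) p := dist_nonneg
    simp only [Function.comp_apply] at hn
    unfold gromovProduct at hk1 ⊢
    linarith
  linarith [hX.le h1 ht]

end Dilation

/-! ### Backward orbits escaping at linear speed -/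

section PositiveRate

variable {X : Type*} [MetricSpace X] {f : X → X} {x : ℕ → X}

/-- A backward orbit whose distance from `p` grows linearly along an arithmetic progression has
positive rate. -/
theorem stepRate_pos {p : X} {σ : ℕ → ℝ} {b : ℝ}
    (hσ : ∀ m n, dist (x (n + m)) (x n) ≤ σ m)
    (hb : Tendsto (fun m : ℕ => σ m / m) atTop (𝓝 b)) {k m : ℕ} (hm : 1 ≤ m) {D : ℝ} (hD : 0 < D)
    (hgrow : ∀ j : ℕ, dist (x (k + j * m)) p + D ≤ dist (x (k + (j + 1) * m)) p) : 0 < b := by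
  have hlin (j : ℕ) : dist (x k) p + j * D ≤ dist (x (k + j * m)) p := by
    induction j with
    | zero => simp
    | succ j ih =>
      have := hgrow j
      push_cast
      linarith
  have hm' : (0 : ℝ) < m := by exact_mod_cast hm
  refine lt_of_lt_of_le (div_pos hD hm') (ge_of_tendsto
    (hb.comp (tendsto_id.atTop_mul_const' (show 0 < m by omega))) ?_)
  filter_upwards [eventually_gt_atTop 0] with j hj
  have h1 := hσ (j * m) k
  have h2 := dist_triangle (x (k + j * m)) (x k) p
  have h3 := hlin j
  have hj' : (0 : ℝ) < j := by exact_mod_cast hj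
  simp only [Function.comp_apply, id_eq]
  rw [div_le_div_iff₀ hm' (by positivity)]
  push_cast
  have h4 : (j : ℝ) * D ≤ σ (j * m) := by linarith
  nlinarith

/-- If the rate is positive, then by the four-point condition for `x k`, `x (k + m)`,
`x (k + 2 * m)` and `p`, the distance from `p` increases along progressions with a large
difference `m`, once it has started to increase. -/
theorem HasGromovInequality.exists_dist_growth {δ : ℝ} (hX : HasGromovInequality X δ)
    {p : X} (hp : Tendsto (fun n => dist (x n) p) atTop atTop) {σ : ℕ → ℝ} {b : ℝ}
    (hσ : ∀ m n, dist (x (n + m)) (x n) ≤ σ m)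
    (hlim : ∀ m, Tendsto (fun n => dist (x (n + m)) (x n)) atTop (𝓝 (σ m)))
    (hb : Tendsto (fun m : ℕ => σ m / m) atTop (𝓝 b)) (hbσ : ∀ m, b * m ≤ σ m) (hb0 : 0 < b)
    (D : ℝ) : ∃ m : ℕ, 1 ≤ m ∧ ∃ N, ∀ k ≥ N, dist (x k) p + D ≤ dist (x (k + m)) p := by
  wlog hD : 0 < D generalizing D
  · obtain ⟨m, hm, N, hN⟩ := this 1 one_pos
    exact ⟨m, hm, N, fun k hk => by linarith [hN k hk]⟩
  -- `m` is large enough for `σ m` to be much smaller than `2 * b * m`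
  obtain ⟨m, hm1, hm2, hm3⟩ := ((hb.eventually_lt_const (show b < 3 / 2 * b by linarith)).and
    ((eventually_ge_atTop 1).and ((tendsto_natCast_atTop_atTop (R := ℝ)).eventually_ge_atTop
      (2 * (D + 1 + 2 * δ) / b)))).exists
  have hm' : (0 : ℝ) < m := by exact_mod_cast hm2
  rw [div_lt_iff₀ hm'] at hm1
  rw [div_le_iff₀ hb0] at hm3
  have hconv : ∀ᶠ k in atTop, σ (2 * m) - 1 < dist (x (k + 2 * m)) (x k) :=
    (hlim (2 * m)).eventually_const_lt (by linarith)
  obtain ⟨N₀, hN₀⟩ := eventually_atTop.1 hconv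
  have hfour (k : ℕ) (hk : N₀ ≤ k) :
      dist (x (k + m)) p + D ≤ max (dist (x k) p) (dist (x (k + 2 * m)) p) := by
    have h1 := hN₀ k hk
    have h2 := hbσ (2 * m)
    have h3 := hσ m k
    have h4 := hσ m (k + m)
    rw [add_assoc, ← two_mul] at h4
    push_cast at h2
    have h5 := hX p (x k) (x (k + m)) (x (k + 2 * m))
    rw [dist_comm] at h1 h3 h4
    rcases min_cases (gromovProduct p (x k) (x (k + m)))
      (gromovProduct p (x (k + m)) (x (k + 2 * m))) with ⟨h6, -⟩ | ⟨h6, -⟩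
    · refine le_max_of_le_right ?_
      rw [h6] at h5
      unfold gromovProduct at h5
      linarith
    · refine le_max_of_le_left ?_
      rw [h6] at h5
      unfold gromovProduct at h5
      linarith
  have hback (i : ℕ) (hi : N₀ ≤ i) (j : ℕ)
      (h : dist (x (i + (j + 1) * m)) p < dist (x (i + j * m)) p + D) :
      dist (x (i + j * m)) p ≤ dist (x i) p := by
    induction j with
    | zero => simp
    | succ j ih =>
      have h1 := hfour (i + j * m) (by omega)
      have e1 : i + j * m + m = i + (j + 1) * m := by ring
      have e2 : i + j * m + 2 * m = i + (j + 1 + 1) * m := by ring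
      rw [e1, e2] at h1
      have h2 : dist (x (i + (j + 1) * m)) p + D ≤ dist (x (i + j * m)) p :=
        (le_max_iff.1 h1).resolve_right (not_le.2 h)
      linarith [ih (by linarith)]
  obtain ⟨B, hB⟩ : ∃ B : ℝ, ∀ i < m, dist (x (N₀ + i)) p ≤ B := by
    obtain ⟨B, hB⟩ := ((Finset.range m).image fun i => dist (x (N₀ + i)) p).bddAbove
    exact ⟨B, fun i hi => hB (by simpa using ⟨i, hi, rfl⟩)⟩
  obtain ⟨N, hN⟩ := eventually_atTop.1 (hp.eventually_gt_atTop B)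
  refine ⟨m, hm2, max N N₀, fun k hk => ?_⟩
  by_contra! h
  have hkN := hN k (le_of_max_le_left hk)
  have hk₀ := le_of_max_le_right hk
  have e := Nat.mod_add_div' (k - N₀) m
  have hlt := Nat.mod_lt (k - N₀) (show m > 0 by omega)
  set i := (k - N₀) % m
  set j := (k - N₀) / m
  have ek : k = N₀ + i + j * m := by omega
  have ek' : k + m = N₀ + i + (j + 1) * m := by rw [ek]; ring
  rw [ek'] at h
  rw [ek] at h hkN
  exact absurd (hback (N₀ + i) (by omega) j h) (by linarith [hB i hlt])

/-- Linear growth of the distance from `p` makes the sequence a quasi-geodesic ray. -/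
theorem exists_isDiscreteQuasiGeodesicRay
    {C : ℝ} (hC : ∀ n, dist (x n) (x (n + 1)) ≤ C) {p : X} {m N : ℕ} (hm : 1 ≤ m)
    (hgrow : ∀ k ≥ N, dist (x k) p + 1 ≤ dist (x (k + m)) p) :
    ∃ A B : ℝ, 1 ≤ A ∧ 0 ≤ B ∧ IsDiscreteQuasiGeodesicRay A B x := by
  have hC0 : 0 ≤ C := dist_nonneg.trans (hC 0)
  have hlin (k : ℕ) (hk : N ≤ k) (j : ℕ) : dist (x k) p + j ≤ dist (x (k + j * m)) p := by
    induction j with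
    | zero => simp
    | succ j ih =>
      have := hgrow (k + j * m) (by omega)
      rw [show k + j * m + m = k + (j + 1) * m by ring] at this
      push_cast
      linarith
  have hm' : (1 : ℝ) ≤ m := by exact_mod_cast hm
  -- lower bound: divide the number of steps by `m`
  have hlow (k l : ℕ) : (l : ℝ) / m - (1 + m * C + 2 * N * C) ≤ dist (x (k + l)) (x k) := by
    have e : l % m + l / m * m = l := Nat.mod_add_div' l m
    have hlt := Nat.mod_lt l (show m > 0 by omega)
    have h1 := hlin (k + N) (by omega) (l / m)
    have h2 := dist_le_mul_of_step hC (k + N + l / m * m) (l % m)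
    have h3 := dist_le_mul_of_step hC k N
    have h4 := dist_le_mul_of_step hC (k + l) N
    rw [show k + N + l / m * m + l % m = k + l + N by omega] at h2
    have h5 : ((l % m : ℕ) : ℝ) * C ≤ m * C := by gcongr
    have h6 : (l : ℝ) / m - 1 ≤ ((l / m : ℕ) : ℝ) := by
      rw [sub_le_iff_le_add, div_le_iff₀ (by linarith)]
      have : l ≤ (l / m + 1) * m := by rw [add_mul]; omega
      exact_mod_cast this
    have h7 := dist_triangle (x (k + N + l / m * m)) (x (k + N)) p
    have h8 := dist_triangle4 (x (k + l + N)) (x (k + l)) (x k) (x (k + N))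
    have h9 := dist_triangle_left (x (k + N + l / m * m)) (x (k + N)) (x (k + l + N))
    rw [dist_comm (x k)] at h8
    linarith
  have hA : (0 : ℝ) < m + C := by linarith
  have hpair (k l : ℕ) : (m + C)⁻¹ * (l : ℝ) - (1 + m * C + 2 * N * C) ≤ dist (x (k + l)) (x k) ∧
      dist (x (k + l)) (x k) ≤ (m + C) * l + (1 + m * C + 2 * N * C) := by
    constructor
    · refine le_trans ?_ (hlow k l)
      rw [div_eq_inv_mul]
      gcongr
      linarith
    · have h1 := dist_le_mul_of_step hC k l
      have h2 : 0 ≤ (m : ℝ) * l := by positivity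
      have h3 : 0 ≤ 1 + m * C + 2 * N * C := by positivity
      linarith
  refine ⟨m + C, 1 + m * C + 2 * N * C, by linarith, by positivity, fun n k => ?_⟩
  rcases le_total n k with h | h
  · obtain ⟨l, rfl⟩ := Nat.exists_eq_add_of_le h
    rw [dist_comm, abs_sub_comm, Nat.cast_add, add_sub_cancel_left, Nat.abs_cast]
    exact hpair n l
  · obtain ⟨l, rfl⟩ := Nat.exists_eq_add_of_le h
    rw [Nat.cast_add, add_sub_cancel_left, Nat.abs_cast]
    exact hpair k l

/-- Linear growth of the distance from `p` implies that, up to a bounded error, each `x k` lies on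
geodesics from `p` to the later points. -/
theorem HasGromovInequality.exists_le_gromovProduct_of_growth {δ : ℝ}
    (hX : HasGromovInequality X δ) (hδ : 0 ≤ δ)
    {C : ℝ} (hC : ∀ n, dist (x n) (x (n + 1)) ≤ C) {p : X} {m N : ℕ} (hm : 1 ≤ m)
    (hgrow : ∀ k ≥ N, dist (x k) p + δ ≤ dist (x (k + m)) p) :
    ∃ c : ℝ, ∀ k l, k ≤ l → dist (x k) p - c ≤ gromovProduct p (x k) (x l) := by
  have hC0 : 0 ≤ C := dist_nonneg.trans (hC 0)
  have hmC : 0 ≤ (m : ℝ) * C := by positivity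
  have hNC : 0 ≤ (N : ℝ) * C := by positivity
  have h0 : 0 ≤ dist (x 0) p := dist_nonneg
  refine ⟨2 * (m * C) + δ + N * C + dist (x 0) p, fun k l hkl => ?_⟩
  rcases lt_or_ge k N with hk | hk
  · have h1 := dist_le_mul_of_step hC 0 k
    rw [zero_add] at h1
    have h2 : (k : ℝ) * C ≤ N * C := by gcongr
    linarith [gromovProduct_nonneg p (x k) (x l), dist_triangle (x k) (x 0) p]
  · obtain ⟨d, rfl⟩ := Nat.exists_eq_add_of_le hkl
    have e : d % m + d / m * m = d := Nat.mod_add_div' d m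
    have hlt := Nat.mod_lt d (show m > 0 by omega)
    have h1 := dist_le_mul_of_step hC (k + d / m * m) (d % m)
    rw [show k + d / m * m + d % m = k + d by omega, dist_comm] at h1
    have h2 : ((d % m : ℕ) : ℝ) * C ≤ m * C := by gcongr
    have h3 := gromovProduct_sub_dist_le p (x k) (x (k + d / m * m)) (x (k + d))
    have h4 := hX.le_gromovProduct_of_chain hδ (p := p) (S := m * C)
      (y := fun j => x (k + j * m)) (d / m)
      (fun i _ => by
        have := dist_le_mul_of_step hC (k + i * m) m
        rw [dist_comm, add_mul, one_mul, ← add_assoc]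
        exact this)
      (fun i _ => by
        have := hgrow (k + i * m) (by omega)
        rw [add_mul, one_mul, ← add_assoc]
        exact this)
    simp only [zero_mul, add_zero] at h4
    rcases h4 with h4 | h4
    · linarith
    · rw [h4, zero_mul, add_zero] at h3
      have h6 : gromovProduct p (x k) (x k) = dist (x k) p := by
        simp [gromovProduct]
      rw [h4, zero_mul, add_zero] at h1
      linarith

/-- A sequence that moves along geodesics from `p` up to a bounded error converges to a boundary
point and stays in a geodesic region with that vertex. -/
theorem HasGromovInequality.exists_tendsto_of_le_gromovProduct [ProperSpace X] {δ : ℝ}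
    (hX : HasGromovInequality X δ) (hgeo : IsGeodesicSpace X) {p : X}
    (hp : Tendsto (fun n => dist (x n) p) atTop atTop) {c : ℝ}
    (h : ∀ k l, k ≤ l → dist (x k) p - c ≤ gromovProduct p (x k) (x l)) :
    ∃ η : GromovBoundary X, Tendsto x atTop (boundaryNhds η) ∧ InsideGeodesicRegion x η := by
  obtain ⟨γ, h0, hγ⟩ := hX.exists_tendsto_boundaryNhds hgeo (p := p) (y := x) (by
    intro r
    obtain ⟨N, hN⟩ := eventually_atTop.1 (hp.eventually_ge_atTop (r + c))
    refine ⟨N, fun n hn m hm => ?_⟩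
    rcases le_total n m with hnm | hnm
    · linarith [h n m hnm, hN n hn]
    · rw [gromovProduct_comm]
      linarith [h m n hnm, hN m hm])
  refine ⟨γ.endpoint, hγ, γ, 2 * (|c| + 2 * |δ| + 1), rfl, by positivity, fun k => ?_⟩
  set a : ℝ≥0 := ⟨dist (x k) p, dist_nonneg⟩
  obtain ⟨l, hl, hkl⟩ := (((hX.tendsto_boundaryNhds_iff γ p).1 hγ (dist (x k) p)).and
    (eventually_ge_atTop k)).exists
  obtain ⟨t, ht, hat⟩ := (hl.and (eventually_ge_atTop a)).exists
  refine Metric.mem_thickening_iff.2 ⟨γ a, mem_range_self _, ?_⟩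
  have h1 := hX.le (r := dist (x k) p - |c|) (by linarith [h k l hkl, le_abs_self c])
    (ht.trans' (by linarith [abs_nonneg c]))
  have h2 := γ.gromovProduct_eq hat
  rw [gromovProduct_comm, h0] at h2
  have ha : (a : ℝ) = dist (x k) p := rfl
  have h3 := hX.le (r := dist (x k) p - |c| - |δ|) (h1.trans' (by linarith [le_abs_self δ]))
    (h2.ge.trans' (by rw [ha]; linarith [abs_nonneg c, abs_nonneg δ]))
  have h4 : dist (γ a) p = a := by
    rw [← h0, γ.dist_eq, NNReal.coe_zero, sub_zero, NNReal.abs_eq]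
  unfold gromovProduct at h3
  rw [h4, ha] at h3
  linarith [le_abs_self δ]

end PositiveRate

/-! ### Stable dilations -/

section StableDilation

variable {X : Type*} [MetricSpace X] {f : X → X} {x : ℕ → X}

theorem tendsto_ereal_div_natCast {L : ℕ → EReal} {u v : ℕ → ℝ} {a : ℝ}
    (hu : ∀ n, (u n : EReal) ≤ L n) (hv : ∀ n, L n ≤ v n)
    (hua : Tendsto (fun n : ℕ => u n / n) atTop (𝓝 a))
    (hva : Tendsto (fun n : ℕ => v n / n) atTop (𝓝 a)) :
    Tendsto (fun n : ℕ => L n / (n : EReal)) atTop (𝓝 (a : EReal)) := by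
  have hcoe (w : ℕ → ℝ) (n : ℕ) : ((w n / n : ℝ) : EReal) = (w n : EReal) / (n : EReal) := by
    rw [EReal.coe_div, EReal.coe_coe_eq_natCast]
  have hn (n : ℕ) : (0 : EReal) ≤ (n : EReal) := by
    rw [← EReal.coe_coe_eq_natCast]; exact_mod_cast n.cast_nonneg
  refine tendsto_of_tendsto_of_tendsto_of_le_of_le (EReal.tendsto_coe.2 hua)
    (EReal.tendsto_coe.2 hva) (fun n => ?_) (fun n => ?_)
  · simp only [hcoe]
    exact EReal.div_le_div_right_of_nonneg (hn n) (hu n)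
  · simp only [hcoe]
    exact EReal.div_le_div_right_of_nonneg (hn n) (hv n)

theorem logDilation_iterate_le (hx : IsBackwardOrbit f x) {η : GromovBoundary X}
    (hη : Tendsto x atTop (boundaryNhds η)) {σ : ℕ → ℝ}
    (hσ : ∀ m n, dist (x (n + m)) (x n) ≤ σ m) (p : X) (m : ℕ) :
    logDilation (f^[m]) η p ≤ σ m := by
  refine logDilation_le_of_tendsto ((tendsto_add_atTop_iff_nat m).2 hη) fun n => ?_
  rw [hx.iterate_apply]
  linarith [hσ m n, dist_triangle (x (n + m)) (x n) p]

/-- If the backward orbit stays in a geodesic region with vertex `η`, then a point `z` close to `η`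
sees it at distance `d(z, p) - d(x k, p)` up to a bounded error; since `f^[n]` moves `x (k + n)` to
`x k`, it must bring `z` closer to `p` by about `σ n`. -/
theorem HasGromovInequality.isStableDilation_exp {δ : ℝ} (hX : HasGromovInequality X δ)
    (hf : LipschitzWith 1 f) (hx : IsBackwardOrbit f x) {η : GromovBoundary X}
    (hη : Tendsto x atTop (boundaryNhds η)) (hreg : InsideGeodesicRegion x η) {σ : ℕ → ℝ} {b : ℝ}
    (hσ : ∀ m n, dist (x (n + m)) (x n) ≤ σ m)
    (hlim : ∀ m, Tendsto (fun n => dist (x (n + m)) (x n)) atTop (𝓝 (σ m)))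
    (hb : Tendsto (fun m : ℕ => σ m / m) atTop (𝓝 b)) {q : X} {c : ℝ}
    (h : ∀ k l, k ≤ l → dist (x k) q - c ≤ gromovProduct q (x k) (x l)) :
    IsStableDilation f η (Real.exp b) := by
  refine ⟨Real.exp_pos b, fun p => ?_⟩
  rw [Real.log_exp]
  obtain ⟨γ, R, rfl, -, hR⟩ := hreg
  obtain ⟨c', hc'⟩ := hX.exists_forall_mem_geodesicRegion γ R p
  set K := 2 * c' + 2 * (c + 2 * dist p q) + 1
  refine tendsto_ereal_div_natCast (u := fun n => σ n - K) (fun n => ?_)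
    (logDilation_iterate_le hx hη hσ p) ?_ hb
  · obtain ⟨k, hk⟩ := ((hlim n).eventually_const_lt (sub_one_lt (σ n))).exists
    refine le_logDilation_of_eventually ?_
    filter_upwards [hc' _ (hR (k + n))] with z hz
    have h1 := dist_iterate_le hf n z (x (k + n))
    rw [hx.iterate_apply, dist_comm z] at h1
    have h2 := dist_triangle (f^[n] z) (x k) p
    have h3 := h k (k + n) (by omega)
    have h4 := gromovProduct_sub_dist_le_base q p (x k) (x (k + n))
    have h5 := dist_triangle (x k) q p
    rw [dist_comm q p] at h4 h5
    rw [dist_comm] at hk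
    unfold gromovProduct at hz h3 h4
    linarith
  · have h0 : Tendsto (fun n : ℕ => K / n) atTop (𝓝 0) := tendsto_const_div_atTop_nhds_zero_nat K
    simpa [sub_div] using hb.sub h0

/-- If the rate is zero, then so is the escape rate of the forward orbits, which bounds the
dilations from below. -/
theorem isStableDilation_one (hf : LipschitzWith 1 f) (hx : IsBackwardOrbit f x)
    {η : GromovBoundary X} (hη : Tendsto x atTop (boundaryNhds η)) {σ : ℕ → ℝ}
    (hσ : ∀ m n, dist (x (n + m)) (x n) ≤ σ m)
    (hb : Tendsto (fun m : ℕ => σ m / m) atTop (𝓝 0)) : IsStableDilation f η 1 := by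
  refine ⟨one_pos, fun p => ?_⟩
  rw [Real.log_one]
  obtain ⟨c, hc, hcz⟩ := tendsto_dist_iterate_div hf p
  have hc0 : c = 0 := by
    refine le_antisymm (ge_of_tendsto hb ?_) (ge_of_tendsto' hc fun n => by positivity)
    filter_upwards [eventually_gt_atTop 0] with m hm
    rw [le_div_iff₀ (by exact_mod_cast hm)]
    have h1 := hcz (x (0 + m)) m
    rw [hx.iterate_apply, dist_comm] at h1
    exact h1.trans (hσ m 0)
  rw [hc0] at hc
  refine tendsto_ereal_div_natCast (u := fun n => -dist (f^[n] p) p) (fun n => ?_)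
    (logDilation_iterate_le hx hη hσ p) (by simpa [neg_div] using hc.neg) hb
  refine le_logDilation_of_eventually (Eventually.of_forall fun z => ?_)
  linarith [dist_triangle (f^[n] z) (f^[n] p) p, dist_iterate_le hf n z p]

end StableDilation

/-! ### Backward orbits of rate zero -/

section ZeroRate

variable {X : Type*} [MetricSpace X] {f : X → X} {x : ℕ → X}

/-- For an elliptic map with compact limit retract, backward orbits escape at linear speed. -/
theorem IsElliptic.stepRate_pos [ProperSpace X] (hgeo : IsGeodesicSpace X)
    (hf : LipschitzWith 1 f) (he : IsElliptic f) (hL : IsCompact (limitRetract f))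
    (hx : IsBackwardOrbit f x) {p : X} (hp : Tendsto (fun n => dist (x n) p) atTop atTop)
    {σ : ℕ → ℝ} {b : ℝ} (hσ : ∀ m n, dist (x (n + m)) (x n) ≤ σ m)
    (hb : Tendsto (fun m : ℕ => σ m / m) atTop (𝓝 b)) : 0 < b := by
  obtain ⟨M, hM, R, hR⟩ := he.exists_dist_iterate_add_one_le hgeo hf hL p
  obtain ⟨N, hN⟩ := eventually_atTop.1 (hp.eventually_ge_atTop R)
  refine GromovDynamics.stepRate_pos (p := p) hσ hb hM one_pos (k := N) fun j => ?_
  have h1 := hR (x (N + (j + 1) * M)) (hN _ (by omega))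
  rwa [add_mul, one_mul, ← add_assoc, hx.iterate_apply, add_assoc, ← add_one_mul] at h1

/-- A backward orbit of rate zero converges to the Denjoy--Wolff point. Otherwise some `x n` far
from `p` has bounded Gromov product with the forward orbit of `p`, and so, inductively, have the
points `x (n + j * k)`, which makes their distances from `p` grow linearly in `j`. -/
theorem HasGromovInequality.tendsto_denjoyWolffPoint [ProperSpace X] {δ : ℝ}
    (hX : HasGromovInequality X δ) (hδ : 0 ≤ δ) (hf : LipschitzWith 1 f)
    (he : ¬ IsElliptic f) {ζ : GromovBoundary X} (hζ : IsDenjoyWolffPoint f ζ)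
    (hx : IsBackwardOrbit f x) {C : ℝ} (hC : ∀ n, dist (x n) (x (n + 1)) ≤ C) {p : X}
    (hp : Tendsto (fun n => dist (x n) p) atTop atTop)
    {σ : ℕ → ℝ} (hσ : ∀ m n, dist (x (n + m)) (x n) ≤ σ m)
    (hb : Tendsto (fun m : ℕ => σ m / m) atTop (𝓝 0)) : Tendsto x atTop (boundaryNhds ζ) := by
  obtain ⟨γ, rfl⟩ := GeodesicRay.exists_endpoint_eq ζ
  rw [hX.tendsto_boundaryNhds_iff γ p]
  by_contra! ⟨r, hr⟩
  obtain ⟨k₁, hk₁⟩ := eventually_atTop.1 ((hX.tendsto_boundaryNhds_iff γ p).1 (hζ p) (r + δ))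
  obtain ⟨k, hkp, hk, hk1⟩ := (((tendsto_dist_iterate hf he p).eventually_ge_atTop
    (2 * (r + 2 * δ) + δ + 1)).and ((eventually_ge_atTop k₁).and (eventually_ge_atTop 1))).exists
  obtain ⟨n, hn, hnp⟩ := (hr.and_eventually
    (hp.eventually_ge_atTop (r + 3 * δ + k * C))).exists
  have hbad : ∀ l ≥ k₁, gromovProduct p (x n) (f^[l] p) < r + δ := by
    intro l hl
    by_contra! h
    refine hn ?_
    filter_upwards [hk₁ l hl] with t ht
    linarith [hX.le h ht]
  have hstep (i : ℕ) (hi : gromovProduct p (x (n + i * k)) (f^[k] p) < r + 2 * δ) :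
      dist (x (n + i * k)) p + (δ + 1) ≤ dist (x (n + (i + 1) * k)) p := by
    have h1 := dist_iterate_le hf k (x (n + (i + 1) * k)) p
    rw [show n + (i + 1) * k = n + i * k + k by ring, hx.iterate_apply] at h1
    rw [show n + (i + 1) * k = n + i * k + k by ring]
    unfold gromovProduct at hi
    linarith
  have key (j : ℕ) : ∀ l ≥ k₁, gromovProduct p (x (n + j * k)) (f^[l] p) < r + 2 * δ := by
    induction j using Nat.strong_induction_on with
    | _ j ih =>
      intro l hl
      by_contra! h
      have hb := hbad l hl
      have hchain := hX.le_gromovProduct_of_chain hδ (p := p) (S := k * C)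
        (y := fun j => x (n + j * k)) j
        (fun i _ => by
          have := dist_le_mul_of_step hC (n + i * k) k
          rw [dist_comm, add_mul, one_mul, ← add_assoc]
          exact this)
        (fun i hi => by linarith [hstep i (ih i hi k hk)])
      simp only [zero_mul, add_zero] at hchain
      rcases hchain with h1 | rfl
      · have h2 : r + 2 * δ ≤ gromovProduct p (x n) (x (n + j * k)) := by linarith
        linarith [hX.le h2 h]
      · rw [zero_mul, add_zero] at h
        linarith
  exact lt_irrefl 0 (stepRate_pos hσ hb hk1 (by linarith) fun j => hstep j (key j k hk))

end ZeroRate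

/-! ### Busemann functions and horospheres -/

section Busemann

variable {X : Type*} [MetricSpace X]

theorem GeodesicRay.antitone_dist_sub (γ : GeodesicRay X) (z : X) :
    Antitone fun n : ℕ => dist z (γ n) - n := by
  refine antitone_nat_of_succ_le fun n => ?_
  have h1 := dist_triangle z (γ n) (γ ((n + 1 : ℕ) : ℝ≥0))
  rw [γ.dist_eq] at h1
  push_cast at h1 ⊢
  rw [sub_add_cancel_left, abs_neg, abs_one] at h1
  linarith

theorem GeodesicRay.bddBelow_dist_sub (γ : GeodesicRay X) (z : X) :
    BddBelow (range fun n : ℕ => dist z (γ n) - n) := by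
  refine ⟨-dist z (γ 0), ?_⟩
  rintro _ ⟨n, rfl⟩
  have h1 := dist_triangle_left (γ 0) (γ n) z
  rw [γ.dist_eq, NNReal.coe_zero, zero_sub, abs_neg, NNReal.abs_eq, NNReal.coe_natCast] at h1
  change -dist z (γ 0) ≤ dist z (γ n) - n
  linarith

/-- The Busemann function `z ↦ lim (d(z, γ n) - n)` of a geodesic ray; the limit is an infimum. -/
noncomputable def GeodesicRay.busemann (γ : GeodesicRay X) : C(X, ℝ) where
  toFun z := ⨅ n : ℕ, (dist z (γ n) - n)
  continuous_toFun := by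
    refine LipschitzWith.continuous (K := 1) (LipschitzWith.of_le_add fun y z => ?_)
    rw [← sub_le_iff_le_add]
    refine le_ciInf fun n => ?_
    have h1 : ⨅ n : ℕ, (dist y (γ n) - n) ≤ dist y (γ n) - n :=
      ciInf_le (γ.bddBelow_dist_sub y) n
    linarith [dist_triangle y z (γ n)]

theorem GeodesicRay.tendsto_busemann (γ : GeodesicRay X) (z : X) :
    Tendsto (fun n : ℕ => dist z (γ n) - n) atTop (𝓝 (γ.busemann z)) :=
  tendsto_atTop_ciInf (γ.antitone_dist_sub z) (γ.bddBelow_dist_sub z)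

theorem GeodesicRay.busemann_apply_natCast (γ : GeodesicRay X) (n : ℕ) :
    γ.busemann (γ n) = -n := by
  refine tendsto_nhds_unique (γ.tendsto_busemann (γ n)) (tendsto_const_nhds.congr' ?_)
  filter_upwards [eventually_ge_atTop n] with m hm
  have hm' : (n : ℝ) ≤ m := by exact_mod_cast hm
  rw [γ.dist_eq, NNReal.coe_natCast, NNReal.coe_natCast, abs_of_nonpos (by linarith)]
  ring

theorem horofunction_mk (h : C(X, ℝ)) (p z : X) :
    horofunction (QuotientAddGroup.mk (s := constFunctions X) h) p z = h z - h p := by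
  have e : QuotientAddGroup.mk (s := constFunctions X) h =
      QuotientAddGroup.mk (s := constFunctions X) (h - ContinuousMap.const X (h p)) := by
    rw [QuotientAddGroup.eq]
    exact ⟨-h p, fun z => by simp; ring⟩
  rw [e, ← eq_horofunction _ p (by simp)]
  simp

theorem continuous_horofunction_apply (p z : X) :
    Continuous fun a : ContModConst X => horofunction a p z := by
  refine (QuotientAddGroup.isQuotientMap_mk _).continuous_iff.2 ?_
  have : (fun a : ContModConst X => horofunction a p z) ∘ QuotientAddGroup.mk =
      fun h : C(X, ℝ) => h z - h p := funext fun h => horofunction_mk h p z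
  rw [this]
  fun_prop

/-- The points of a ray tend to the class of its Busemann function: the convergence is monotone, so
that it is locally uniform by Dini's theorem. -/
theorem GeodesicRay.tendsto_horoEmbedding (γ : GeodesicRay X) :
    Tendsto (fun n : ℕ => horoEmbedding (γ n)) atTop
      (𝓝 (QuotientAddGroup.mk (s := constFunctions X) γ.busemann)) := by
  let g : ℕ → C(X, ℝ) := fun n => ⟨fun z => dist z (γ n) - n, by fun_prop⟩
  have hg : Tendsto g atTop (𝓝 γ.busemann) :=
    ContinuousMap.tendsto_of_antitone_of_pointwise
      (fun m n hmn z => γ.antitone_dist_sub z hmn) γ.tendsto_busemann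
  refine ((QuotientAddGroup.continuous_mk.tendsto _).comp hg).congr fun n => ?_
  refine QuotientAddGroup.eq.2 ⟨n, fun z => ?_⟩
  simp [g, dist_comm (γ n) z]

theorem GeodesicRay.busemann_mem_horofunctionBoundary (γ : GeodesicRay X) :
    QuotientAddGroup.mk (s := constFunctions X) γ.busemann ∈ horofunctionBoundary X := by
  refine ⟨mem_closure_of_tendsto γ.tendsto_horoEmbedding
    (Eventually.of_forall fun n => mem_range_self _), ?_⟩
  rintro ⟨y, hy⟩
  obtain ⟨c, hc⟩ := QuotientAddGroup.eq.1 hy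
  -- the Busemann function is not bounded below
  obtain ⟨n, hn⟩ := exists_nat_gt (-c)
  have h1 := hc (γ n)
  simp only [ContinuousMap.add_apply, ContinuousMap.neg_apply, ContinuousMap.coe_mk,
    γ.busemann_apply_natCast] at h1
  linarith [dist_nonneg (x := y) (y := γ n)]

theorem HasGromovInequality.isAssociated_busemann {δ : ℝ} (hX : HasGromovInequality X δ)
    (γ : GeodesicRay X) :
    IsAssociated (QuotientAddGroup.mk (s := constFunctions X) γ.busemann) γ.endpoint := by
  refine ⟨γ.busemann_mem_horofunctionBoundary, ?_⟩
  refine tendsto_id'.1 ?_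
  rw [hX.tendsto_boundaryNhds_iff γ (γ 0)]
  intro r
  obtain ⟨N, hN⟩ := exists_nat_gt (r + δ + 1)
  have h0 : γ.busemann (γ 0) = 0 := by simpa using γ.busemann_apply_natCast 0
  have h1 := (continuous_horofunction_apply (γ 0) (γ N)).tendsto
    (QuotientAddGroup.mk (s := constFunctions X) γ.busemann)
  rw [horofunction_mk, γ.busemann_apply_natCast, h0, sub_zero] at h1
  filter_upwards [tendsto_comap.eventually (h1.eventually_lt_const (lt_add_one _))] with y hy
  have hy' : dist y (γ N) - dist y (γ 0) < -N + 1 := by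
    have := horofunction_mk ⟨fun z => dist y z, by fun_prop⟩ (γ 0) (γ N)
    exact (this.symm.trans_lt hy)
  have h2 : r + δ ≤ gromovProduct (γ 0) y (γ N) := by
    have h3 : dist (γ N) (γ 0) = N := by
      rw [γ.dist_eq, NNReal.coe_zero, sub_zero, NNReal.abs_eq, NNReal.coe_natCast]
    unfold gromovProduct
    rw [h3]
    linarith
  filter_upwards [eventually_ge_atTop (N : ℝ≥0)] with t ht
  have h4 := γ.gromovProduct_eq ht
  rw [NNReal.coe_natCast] at h4
  have h5 := hX.le h2 (show r + δ ≤ gromovProduct (γ 0) (γ N) (γ t) by linarith)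
  rwa [add_sub_cancel_right] at h5

/-- Up to a bounded error, the Busemann function of a ray can be computed along any points tending
to the endpoint of the ray. -/
theorem HasGromovInequality.eventually_abs_busemann_sub_le {δ : ℝ} (hX : HasGromovInequality X δ)
    (γ : GeodesicRay X) (z : X) :
    ∀ᶠ w in boundaryNhds γ.endpoint,
      |γ.busemann z - (dist z w - dist w (γ 0))| ≤ 2 * δ := by
  filter_upwards [hX.eventually_boundaryNhds γ (γ 0) (dist z (γ 0))] with w hw
  refine le_of_tendsto ((γ.tendsto_busemann z).sub_const _).abs ?_
  filter_upwards [tendsto_natCast_atTop_atTop.eventually hw] with n hn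
  have h1 := hX.le (p := γ 0) (x := z) (y := w) (z := γ n) le_rfl
    (hn.trans' (gromovProduct_le_left (γ 0) z w))
  have hn' := hn
  rw [gromovProduct_comm] at hn'
  have h2 := hX.le (p := γ 0) (x := z) (y := γ n) (z := w) le_rfl
    (hn'.trans' (gromovProduct_le_left (γ 0) z (γ n)))
  have h3 : dist (γ n) (γ 0) = n := by
    rw [γ.dist_eq, NNReal.coe_zero, sub_zero, NNReal.abs_eq, NNReal.coe_natCast]
  unfold gromovProduct at h1 h2
  rw [h3] at h1 h2
  rw [abs_le]
  constructor <;> linarith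

/-- A backward orbit of a non-elliptic map avoids the small horospheres centred at the
Denjoy--Wolff point: forward iteration does not increase the Busemann function by more than
a bounded amount. -/
theorem HasGromovInequality.exists_notMem_horosphere [ProperSpace X] {f : X → X} {x : ℕ → X}
    {δ : ℝ} (hX : HasGromovInequality X δ) (hf : LipschitzWith 1 f) (he : ¬ IsElliptic f)
    (γ : GeodesicRay X) (hγ : IsDenjoyWolffPoint f γ.endpoint) (hx : IsBackwardOrbit f x)
    (p : X) : ∃ c : ℝ, ∀ n, x n ∉
      horosphere (QuotientAddGroup.mk (s := constFunctions X) γ.busemann) p c := by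
  refine ⟨γ.busemann (x 0) - 4 * δ - γ.busemann p - 1, fun n hn => ?_⟩
  have hn : horofunction _ p (x n) ≤ _ := hn
  rw [horofunction_mk] at hn
  obtain ⟨K, hK⟩ := eventually_atTop.1 ((hγ (γ 0)).eventually
    ((hX.eventually_abs_busemann_sub_le γ (x 0)).and
      (hX.eventually_abs_busemann_sub_le γ (x n))))
  -- at a record time `l`, the orbit of `γ 0` is farther from `γ 0` than at time `l - n`
  obtain ⟨l, hl, hlK⟩ := ((frequently_high_scores (tendsto_dist_iterate hf he (γ 0))).and_eventually
    (eventually_ge_atTop (K + n))).exists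
  have h1 := (abs_le.1 (hK l (by omega)).1).2
  have h2 := (abs_le.1 (hK (l - n) (by omega)).2).1
  have h3 : dist (f^[l - n] (γ 0)) (γ 0) ≤ dist (f^[l] (γ 0)) (γ 0) := by
    rcases Nat.eq_zero_or_pos n with rfl | hn0
    · simp
    · exact (hl (l - n) (by omega)).le
  have h4 := dist_iterate_le hf n (x (0 + n)) (f^[l - n] (γ 0))
  rw [hx.iterate_apply, ← Function.iterate_add_apply, Nat.add_sub_cancel' (by omega),
    zero_add] at h4
  linarith

end Busemann

end GromovDynamics

theorem theorem1p6 {X : Type*} [MetricSpace X] [ProperSpace X]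
    (hgeo : IsGeodesicSpace X) (hhyp : IsGromovHyperbolic X)
    (f : X → X) (hf : LipschitzWith 1 f) (hwe : ¬ IsWeaklyElliptic f)
    (x : ℕ → X) (hx : IsBackwardOrbit f x) (hstep : HasBoundedStep x)
    (hnc : ¬ IsCompact (closure (range x))) :
    ∃ b : ℝ, IsBackwardStepRate x b ∧
      ∃ η : GromovBoundary X, IsBRFP f η ∧ Tendsto x atTop (boundaryNhds η) ∧
        ((0 < b ∧ IsRepelling f η ∧
            (∃ Λ : ℝ, IsStableDilation f η Λ ∧ Real.log Λ = b) ∧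
            (∃ A B : ℝ, 1 ≤ A ∧ 0 ≤ B ∧ IsDiscreteQuasiGeodesicRay A B x) ∧
            InsideGeodesicRegion x η) ∨
          (b = 0 ∧ IsParabolic f ∧ IsDenjoyWolffPoint f η ∧
            ∃ a : ContModConst X, IsAssociated a η ∧
              ∀ p : X, ∃ c : ℝ, ∀ n, x n ∉ horosphere a p c)) := by
  obtain ⟨δ₀, hδ₀, hhyp⟩ := hhyp
  have hX := hhyp.hasGromovInequality hδ₀ hgeo
  have hδ : 0 ≤ 3 * δ₀ := by positivity
  obtain ⟨C, hC⟩ := id hstep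
  obtain ⟨σ, b, hσ, hlim, hb, hbσ, hb0⟩ := hx.exists_stepRate hf hstep
  have hp := hx.tendsto_dist hf hwe hnc (x 0)
  refine ⟨b, ⟨σ, fun m _ => hlim m, hb⟩, ?_⟩
  rcases hb0.lt_or_eq with hb0 | rfl
  · obtain ⟨m, hm, N, hN⟩ := hX.exists_dist_growth hp hσ hlim hb hbσ hb0 (3 * δ₀ + 1)
    obtain ⟨c, hc⟩ := hX.exists_le_gromovProduct_of_growth hδ hC hm
      (fun k hk => by linarith [hN k hk])
    obtain ⟨η, hη, hreg⟩ := hX.exists_tendsto_of_le_gromovProduct hgeo hp hc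
    have hΛ := hX.isStableDilation_exp hf hx hη hreg hσ hlim hb hc
    have hη' := hX.isBRFP hf hx hstep hη
    exact ⟨η, hη', hη, Or.inl ⟨hb0, ⟨hη', _, hΛ, Real.one_lt_exp_iff.2 hb0⟩,
      ⟨_, hΛ, Real.log_exp b⟩, exists_isDiscreteQuasiGeodesicRay hC hm
        (fun k hk => by linarith [hN k hk]), hreg⟩⟩
  · have he : ¬ IsElliptic f := fun he =>
      lt_irrefl 0 (he.stepRate_pos hgeo hf (not_not.1 fun hL => hwe ⟨he, hL⟩) hx hp hσ hb)
    obtain ⟨ζ, hζ⟩ := hX.exists_isDenjoyWolffPoint hgeo hf he (x 0)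
    have hη := hX.tendsto_denjoyWolffPoint hδ hf he hζ hx hC hp hσ hb
    have hζ' := hX.isBRFP hf hx hstep hη
    obtain ⟨γ, rfl⟩ := GeodesicRay.exists_endpoint_eq ζ
    exact ⟨_, hζ', hη, Or.inr ⟨rfl, ⟨he, _, hζ, hζ', isStableDilation_one hf hx hη hσ hb⟩, hζ,
      _, hX.isAssociated_busemann γ, hX.exists_notMem_horosphere hf he γ hζ hx⟩⟩
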